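/- All graphs are finite and may have loops, multiple edges, and components that are circles, where the circle $\bigcirc$ is a single edge with no vertex. A loop contributes twice to the degree of its vertex and appears twice among the edges incident with it. Let $k,\ell\in\mathbb{N}=\mathbb{Z}_{\ge 0}$, let $V_k=\mathbb{C}^k$ have standard basis $e_1,\dots,e_k$ and let $V_{2\ell}=\mathbb{C}^{2\ell}$ have standard basis $f_1,\dots,f_{2\ell}$. Put $g_i=-f_{i+\ell}$ for $i\le \ell$ and $g_i=f_{i-\ell}$ for $i>\ell$. A $(k,2\ell)$-color edge coloring model is an element $h\in (S V_k\otimes\bigwedge V_{2\ell})^*$, where $SV_k$ is the symmetric algebra (product $\odot$) and $\bigwedge V_{2\ell}$ is the exterior algebra. For a graph $G=(V,E)$, a set $F\subseteq E$ is called Eulerian if all degrees of $(V,F)$ are even. For an Eulerian set $F$, choose an Eulerian orientation $\omega$ of $(V,F)$ (indegree equals outdegree at each vertex) and a compatible local pairing $\kappa$, i.e. for each vertex $v$ a partition $\kappa_v$ of the edge ends of $F$ at $v$ into ordered pairs $(a_1,a_2)$ with $a_1$ incoming and $a_2$ outgoing at $v$. Let $c(\kappa)$ be the number of circuits into which $\kappa$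 decomposes $F$ (each circle in $F$ counts as one circuit), and let $$s_h(G,F):=(-1)^{c(\kappa)}\sum_{\phi:F\to[2\ell]}\ \sum_{\psi:E\setminus F\to[k]}\ \prod_{v\in V}h\Bigl(\bigodot_{a\in\delta_{E\setminus F}(v)}e_{\psi(a)}\otimes\bigwedge_{(a_1,a_2)\in\kappa_v}f_{\phi(a_1)}\wedge g_{\phi(a_2)}\Bigr),$$ where $\delta_{E\setminus F}(v)$ denotes the edge ends at $v$ of edges not in $F$, and where $\phi$ and $\psi$ are evaluated at an edge end by evaluating them at the edge it belongs to. This number does not depend on the choice of $\omega$ and $\kappa$. The mixed partition function of $h$ is $$p_h(G):=\sum_{F\subseteq E,\ F\text{ Eulerian}}s_h(G,F).$$ For $t\in\mathbb{N}$, a $t$-fragment is a graph with $t$ distinct vertices of degree one labeled $1,\dots,t$. For $t$-fragments $F_1,F_2$, the graph $F_1*F_2$ is obtained from the disjoint union of $F_1$ and $F_2$ by removing the labeled vertices and gluing together, for each $i$, the edge of $F_1$ and the edge of $F_2$ that were incident with the vertices labeled $i$ (a closed chain of glued edges becomes a circle). For a function $f$ from graphs to $\mathbb{C}$, the $t$-th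 edge-connection matrix $M_{f,t}$ is the infinite matrix indexed by $t$-fragments with entries $M_{f,t}(F_1,F_2)=f(F_1*F_2)$. **Theorem.** Let $k,\ell\in\mathbb{N}$, let $h\in (S V_k\otimes\bigwedge V_{2\ell})^*$ and let $f=p_h$. Then $$\mathrm{rk}(M_{f,t})\le (k+2\ell)^t\qquad\text{for every } t\in\mathbb{N}.$$ In particular $f$ has finite edge-rank connectivity, i.e. there is a real number $r>0$ such that $\mathrm{rk}(M_{f,t})\le r^t$ for all $t\in\mathbb{N}$. -/

import Mathlib

open scoped TensorProduct

noncomputable section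

namespace MixedPartition

/-! ### Two facts about pairs of involutions -/

/-- Two fixed-point-free involutions on the same type admit a common two-colouring. -/
lemma exists_two_coloring {X : Type} (σ τ : X → X)
    (hσ : Function.Involutive σ) (hτ : Function.Involutive τ)
    (hσ' : ∀ x, σ x ≠ x) (hτ' : ∀ x, τ x ≠ x) :
    ∃ c : Set X, ∀ x, (σ x ∈ c ↔ x ∉ c) ∧ (τ x ∈ c ↔ x ∉ c) := by
  classical
  let s : Equiv.Perm X := hσ.toPerm
  let u : Equiv.Perm X := hτ.toPerm
  have hs1 : s * s = 1 := by ext x; exact hσ x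
  have hu1 : u * u = 1 := by ext x; exact hτ x
  have hs : s⁻¹ = s := inv_eq_of_mul_eq_one_left hs1
  have hu : u⁻¹ = u := inv_eq_of_mul_eq_one_left hu1
  let p : Equiv.Perm X := s * u
  have hconj : ∀ n : ℤ, s * p ^ n = p ^ (-n) * s := by
    intro n
    have h1 : s * p * s⁻¹ = p⁻¹ := by
      simp only [p, mul_inv_rev, hs, hu]
      rw [← mul_assoc, hs1, one_mul]
    have h2 : s * p ^ n * s⁻¹ = p ^ (-n) := by
      rw [← conj_zpow, h1, inv_zpow, zpow_neg]
    rw [← h2, inv_mul_cancel_right]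
  have key : ∀ x, ¬ p.SameCycle x (s x) := by
    rintro x ⟨n, hn⟩
    obtain ⟨m, rfl | rfl⟩ := Int.even_or_odd' n
    · have : s ((p ^ m) x) = (p ^ m) x := by
        have e1 : (s * p ^ m) x = (p ^ (-m) * s) x := by rw [hconj]
        simp only [Equiv.Perm.mul_apply] at e1
        rw [e1, ← hn, ← Equiv.Perm.mul_apply, ← zpow_add]
        congr 2; ring
      exact hσ' _ this
    · have : s ((p ^ m) x) = s (u ((p ^ m) x)) := by
        have e1 : (s * p ^ m) x = (p ^ (-m) * s) x := by rw [hconj]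
        simp only [Equiv.Perm.mul_apply] at e1
        rw [e1, ← hn, ← Equiv.Perm.mul_apply, ← zpow_add]
        have e2 : -m + (2 * m + 1) = 1 + m := by ring
        rw [e2, zpow_add, zpow_one]
        rfl
      exact hτ' _ (s.injective this).symm
  let S := Equiv.Perm.SameCycle.setoid p
  let q : X → Quotient S := Quotient.mk S
  have hq : ∀ x y, q x = q y ↔ p.SameCycle x y := fun x y => Quotient.eq (r := S)
  let lo : LinearOrder (Quotient S) := linearOrderOfSTO WellOrderingRel
  refine ⟨{x | q x < q (s x)}, fun x => ?_⟩
  have hne : q x ≠ q (s x) := fun h => key x ((hq _ _).1 h)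
  have hss : s (s x) = x := hσ x
  have hux : q (u x) = q (s x) := by
    rw [hq]
    refine ⟨1, ?_⟩
    change s (u (u x)) = s x
    congr 1
    exact hτ x
  have hsux : q (s (u x)) = q x := by
    rw [hq]
    exact ⟨-1, by
      change (p ^ (-1 : ℤ)) (p x) = x
      simp⟩
  constructor
  · change q (s x) < q (s (s x)) ↔ ¬ (q x < q (s x))
    rw [hss, not_lt]
    exact ⟨le_of_lt, fun h => lt_of_le_of_ne h hne.symm⟩
  · change q (u x) < q (s (u x)) ↔ ¬ (q x < q (s x))
    rw [hux, hsux, not_lt]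
    exact ⟨le_of_lt, fun h => lt_of_le_of_ne h hne.symm⟩

/-- If `σ`, `τ` are involutions of a finite type and `σ` has no fixed point, then an orbit of the
group generated by them that contains a fixed point of `τ` contains exactly two of these. -/
lemma exists_other_fixed {X : Type} [Finite X] (σ τ : X → X)
    (hσ : Function.Involutive σ) (hτ : Function.Involutive τ)
    (hσ' : ∀ x, σ x ≠ x) (x : X) (hx : τ x = x) :
    ∃ (y : X) (O : Set X), y ≠ x ∧ τ y = y ∧ x ∈ O ∧ y ∈ O ∧ (∀ z ∈ O, σ z ∈ O) ∧
      (∀ z ∈ O, τ z ∈ O) ∧ (∀ z ∈ O, τ z = z → z = x ∨ z = y) ∧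
      ∀ z ∈ O, ∃ n : ℕ, (fun w => σ (τ w))^[n] x = z := by
  classical
  let s : Equiv.Perm X := hσ.toPerm
  let u : Equiv.Perm X := hτ.toPerm
  have hs1 : s * s = 1 := by ext x; exact hσ x
  have hu1 : u * u = 1 := by ext x; exact hτ x
  have hs : s⁻¹ = s := inv_eq_of_mul_eq_one_left hs1
  have hu : u⁻¹ = u := inv_eq_of_mul_eq_one_left hu1
  let p : Equiv.Perm X := s * u
  have hpinv : p⁻¹ = u * s := by simp only [p, mul_inv_rev, hs, hu]
  have hconj : ∀ n : ℤ, u * p ^ n = p ^ (-n) * u := by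
    intro n
    have h1 : u * p * u⁻¹ = p⁻¹ := by
      rw [hpinv, hu]
      simp only [p]
      rw [mul_assoc, mul_assoc, hu1, mul_one]
    have h2 : u * p ^ n * u⁻¹ = p ^ (-n) := by
      rw [← conj_zpow, h1, inv_zpow, zpow_neg]
    rw [← h2, inv_mul_cancel_right]
  have hux : u x = x := hx
  have hut : ∀ n : ℤ, u ((p ^ n) x) = (p ^ (-n)) x := by
    intro n
    have := congrArg (fun f : Equiv.Perm X => f x) (hconj n)
    simpa [Equiv.Perm.mul_apply, hux] using this
  have hsu : s = p * u := by
    simp only [p]; rw [mul_assoc, hu1, mul_one]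
  have hst : ∀ n : ℤ, s ((p ^ n) x) = (p ^ (1 - n)) x := by
    intro n
    have : s ((p ^ n) x) = p (u ((p ^ n) x)) := by
      exact congrArg (fun f : Equiv.Perm X => f ((p ^ n) x)) hsu
    rw [this, hut, ← Equiv.Perm.mul_apply, sub_eq_add_neg, zpow_add, zpow_one]
  let N := Function.minimalPeriod p x
  have hNpos : 0 < N := by
    apply Function.minimalPeriod_pos_of_mem_periodicPts
    obtain ⟨n, hn, h⟩ := (isOfFinOrder_of_finite p).exists_pow_eq_one
    refine ⟨n, hn, ?_⟩
    change p^[n] x = x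
    rw [← Equiv.Perm.coe_pow, h]; rfl
  have hdvd : ∀ n : ℤ, (p ^ n) x = x ↔ (N : ℤ) ∣ n := by
    intro n
    exact MulAction.zpow_smul_eq_iff_minimalPeriod_dvd (a := p) (b := x) (n := n)
  have heq : ∀ m n : ℤ, (p ^ m) x = (p ^ n) x ↔ (N : ℤ) ∣ m - n := by
    intro m n
    rw [← hdvd, sub_eq_neg_add, zpow_add, Equiv.Perm.mul_apply, zpow_neg,
      Equiv.Perm.inv_eq_iff_eq]
  have heven : Even N := by
    by_contra hodd
    rw [Nat.not_even_iff_odd] at hodd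
    obtain ⟨m, hm⟩ := hodd
    apply hσ' ((p ^ ((m : ℤ) + 1)) x)
    change s _ = _
    rw [hst, heq]
    refine ⟨-1, ?_⟩
    rw [hm]; push_cast; ring
  obtain ⟨m, hm⟩ := heven
  refine ⟨(p ^ (m : ℤ)) x, Set.range fun n : ℤ => (p ^ n) x, ?_, ?_, ⟨0, by simp⟩, ⟨m, rfl⟩,
    ?_, ?_, ?_, ?_⟩
  · intro h
    rw [hdvd] at h
    have := Int.natCast_dvd_natCast.1 h
    have := Nat.le_of_dvd (by omega) this
    omega
  · change u _ = _
    rw [hut, heq]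
    exact ⟨-1, by rw [hm]; push_cast; ring⟩
  · rintro _ ⟨n, rfl⟩; exact ⟨1 - n, (hst n).symm⟩
  · rintro _ ⟨n, rfl⟩; exact ⟨-n, (hut n).symm⟩
  · rintro _ ⟨n, rfl⟩ h
    change u ((p ^ n) x) = (p ^ n) x at h
    rw [hut, heq] at h
    obtain ⟨j, hj⟩ := h
    rw [hm] at hj
    have hn : n = (m : ℤ) * (-j) := by push_cast at hj; linarith
    obtain ⟨i, hi | hi⟩ := Int.even_or_odd' (-j)
    · left
      change (p ^ n) x = x
      rw [hdvd]
      exact ⟨i, by rw [hn, hi, hm]; push_cast; ring⟩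
    · right
      change (p ^ n) x = _
      rw [heq]
      exact ⟨i, by rw [hn, hi, hm]; push_cast; ring⟩
  · rintro _ ⟨n, rfl⟩
    obtain ⟨k, hk⟩ := Int.eq_ofNat_of_zero_le
      (Int.emod_nonneg n (b := (N : ℤ)) (by omega))
    refine ⟨k, ?_⟩
    have h1 : (p ^ (k : ℤ)) x = (p ^ n) x := by
      rw [heq, ← hk]
      exact ⟨-(n / N), by have := Int.emod_add_mul_ediv n N; linarith⟩
    change _ = (p ^ n) x
    rw [← h1, zpow_natCast, Equiv.Perm.coe_pow]
    rfl

/-- If every fibre of `e` has zero or two elements, then `e` has a "partner" involution. -/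
lemma exists_partner {X E : Type} [Finite X] (e : X → E)
    (he : ∀ a, Nat.card {x // e x = a} = 0 ∨ Nat.card {x // e x = a} = 2) :
    ∃ σ : X → X, Function.Involutive σ ∧ (∀ x, σ x ≠ x) ∧ (∀ x, e (σ x) = e x) ∧
      ∀ x y, e y = e x → y = x ∨ y = σ x := by
  have h : ∀ x, ∃ y, y ≠ x ∧ e y = e x ∧ ∀ z, e z = e x → z = x ∨ z = y := by
    intro x
    have h2 : Nat.card {y // e y = e x} = 2 := by
      rcases he (e x) with h | h
      · have : Nonempty {y // e y = e x} := ⟨⟨x, rfl⟩⟩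
        exact absurd h Nat.card_pos.ne'
      · exact h
    obtain ⟨y, hy, huniq⟩ := (Nat.card_eq_two_iff' (⟨x, rfl⟩ : {y // e y = e x})).1 h2
    refine ⟨y.1, fun h => hy (Subtype.ext h), y.2, fun z hz => ?_⟩
    by_cases hzx : z = x
    · exact Or.inl hzx
    · right
      have := huniq ⟨z, hz⟩ (fun h => hzx (congrArg Subtype.val h))
      exact congrArg Subtype.val this
  choose σ h1 h2 h3 using h
  refine ⟨σ, fun x => ?_, h1, h2, h3⟩
  rcases h3 (σ x) x (h2 x).symm with h | h
  · exact absurd h.symm (h1 x)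
  · exact h.symm

/-- Gluing half-edges along a partial matching `τ` produces classes of edges that have either no
free half-edge or exactly two free half-edges. -/
lemma card_free_eq {X E : Type} [Finite X] (e : X → E)
    (he : ∀ a, Nat.card {x // e x = a} = 0 ∨ Nat.card {x // e x = a} = 2)
    (τ : X → X) (hτ : Function.Involutive τ) (r : E → E → Prop)
    (hr : ∀ a b, r a b → ∃ x, e x = a ∧ e (τ x) = b)
    (hr' : ∀ x, Quot.mk r (e (τ x)) = Quot.mk r (e x)) (q : Quot r) :
    Nat.card {x // τ x = x ∧ Quot.mk r (e x) = q} = 0 ∨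
      Nat.card {x // τ x = x ∧ Quot.mk r (e x) = q} = 2 := by
  by_cases hne : Nonempty {x // τ x = x ∧ Quot.mk r (e x) = q}
  swap
  · left
    have := not_nonempty_iff.1 hne
    exact Nat.card_of_isEmpty
  right
  obtain ⟨x, hx, hxq⟩ := hne
  obtain ⟨σ, hσ, hσ', heσ, hσe⟩ := exists_partner e he
  obtain ⟨y, O, hyx, hy, hxO, hyO, hOσ, hOτ, hO, hit⟩ :=
    exists_other_fixed σ τ hσ hτ hσ' x hx
  have hOe : ∀ z w, e w = e z → z ∈ O → w ∈ O := by
    intro z w h hz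
    rcases hσe z w h with rfl | rfl
    · exact hz
    · exact hOσ z hz
  let P : Quot r → Prop := Quot.lift (fun a => ∃ z ∈ O, e z = a) (by
    intro a b hab
    obtain ⟨z, hz, hz'⟩ := hr a b hab
    apply propext
    constructor
    · rintro ⟨w, hw, rfl⟩
      exact ⟨τ z, hOτ z (hOe w z hz hw), hz'⟩
    · rintro ⟨w, hw, rfl⟩
      have h1 : τ z ∈ O := hOe w _ hz' hw
      have h2 := hOτ _ h1
      rw [hτ z] at h2
      exact ⟨z, h2, hz⟩)
  have hP : ∀ z, Quot.mk r (e z) = q → z ∈ O := by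
    intro z hz
    have : P (Quot.mk r (e z)) := by
      rw [hz, ← hxq]; exact ⟨x, hxO, rfl⟩
    obtain ⟨w, hw, hwz⟩ := this
    exact hOe w z hwz.symm hw
  have hQ : ∀ z ∈ O, Quot.mk r (e z) = q := by
    intro z hz
    obtain ⟨n, rfl⟩ := hit z hz
    clear hz
    induction n with
    | zero => exact hxq
    | succ n ih => rw [Function.iterate_succ_apply', heσ, hr', ih]
  rw [Nat.card_eq_two_iff' (⟨x, hx, hxq⟩ : {x // τ x = x ∧ Quot.mk r (e x) = q})]
  refine ⟨⟨y, hy, hQ y hyO⟩, fun h => hyx (congrArg Subtype.val h), ?_⟩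
  rintro ⟨z, hz, hzq⟩ hzx
  rcases hO z (hP z hzq) hz with h | h
  · exact absurd (Subtype.ext h) hzx
  · exact Subtype.ext h

/-! ### Graphs, fragments and gluing -/

/-- A finite graph, possibly with loops, multiple edges and circles. `V` is the set of vertices,
`E` the set of edges and `D` the set of half-edges (edge ends). An edge has two half-edges, which
are attached to (possibly equal) vertices, or it has none; in the latter case it is a circle `○`,
a connected component with one edge and no vertex. -/
structure Multigraph where
  V : Type
  E : Type
  D : Type
  finite_V : Finite V
  finite_E : Finite E
  finite_D : Finite D
  vert : D → V
  edge : D → E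
  card_ends : ∀ e, Nat.card {d // edge d = e} = 0 ∨ Nat.card {d // edge d = e} = 2

attribute [instance] Multigraph.finite_V Multigraph.finite_E Multigraph.finite_D

namespace Multigraph

variable (G : Multigraph)

instance : Fintype G.V := Fintype.ofFinite _
instance : Fintype G.E := Fintype.ofFinite _
instance : Fintype G.D := Fintype.ofFinite _
instance : DecidableEq G.V := Classical.decEq _
instance : DecidableEq G.E := Classical.decEq _
instance : DecidableEq G.D := Classical.decEq _

/-- The degree of a vertex; a loop counts twice. -/
def degree (v : G.V) : ℕ := Nat.card {d : G.D // G.vert d = v}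

end Multigraph

/-- A `t`-fragment: a graph with `t` distinct vertices of degree one labelled by `Fin t`. -/
structure Fragment (t : ℕ) extends Multigraph where
  label : Fin t → V
  label_injective : Function.Injective label
  degree_label : ∀ i, toMultigraph.degree (label i) = 1

namespace Fragment

variable {t : ℕ}

lemma existsUnique_openEnd (F : Fragment t) (i : Fin t) : ∃! d : F.D, F.vert d = F.label i := by
  have h := F.degree_label i
  rw [Multigraph.degree, Nat.card_eq_one_iff_unique] at h
  obtain ⟨h1, ⟨d, hd⟩⟩ := h
  exact ⟨d, hd, fun d' hd' => congrArg Subtype.val (h1.elim ⟨d', hd'⟩ ⟨d, hd⟩)⟩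

/-- The unique half-edge at the vertex labelled `i`. -/
def openEnd (F : Fragment t) (i : Fin t) : F.D := (F.existsUnique_openEnd i).choose

lemma vert_openEnd (F : Fragment t) (i : Fin t) : F.vert (F.openEnd i) = F.label i :=
  (F.existsUnique_openEnd i).choose_spec.1

lemma eq_openEnd (F : Fragment t) {i : Fin t} {d : F.D} (h : F.vert d = F.label i) :
    d = F.openEnd i :=
  (F.existsUnique_openEnd i).choose_spec.2 d h

/-- The edges of `F₁` and `F₂` that carry the same label `i` are to be identified. -/
def GlueRel (F₁ F₂ : Fragment t) (x y : F₁.E ⊕ F₂.E) : Prop :=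
  ∃ i, x = Sum.inl (F₁.edge (F₁.openEnd i)) ∧ y = Sum.inr (F₂.edge (F₂.openEnd i))

open Classical in
/-- The involution of the half-edges of `F₁ ∪ F₂` that swaps the half-edges at labelled vertices
with the same label, and fixes all other half-edges. -/
def glueSwap (F₁ F₂ : Fragment t) : F₁.D ⊕ F₂.D → F₁.D ⊕ F₂.D
  | Sum.inl d => if h : ∃ i, F₁.label i = F₁.vert d then Sum.inr (F₂.openEnd h.choose)
      else Sum.inl d
  | Sum.inr d => if h : ∃ i, F₂.label i = F₂.vert d then Sum.inl (F₁.openEnd h.choose)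
      else Sum.inr d

lemma glueSwap_inl_openEnd (F₁ F₂ : Fragment t) (i : Fin t) :
    glueSwap F₁ F₂ (Sum.inl (F₁.openEnd i)) = Sum.inr (F₂.openEnd i) := by
  have h : ∃ j, F₁.label j = F₁.vert (F₁.openEnd i) := ⟨i, (F₁.vert_openEnd i).symm⟩
  have hj : h.choose = i := F₁.label_injective (h.choose_spec.trans (F₁.vert_openEnd i))
  simp only [glueSwap]
  rw [dif_pos h, hj]

lemma glueSwap_inr_openEnd (F₁ F₂ : Fragment t) (i : Fin t) :
    glueSwap F₁ F₂ (Sum.inr (F₂.openEnd i)) = Sum.inl (F₁.openEnd i) := by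
  have h : ∃ j, F₂.label j = F₂.vert (F₂.openEnd i) := ⟨i, (F₂.vert_openEnd i).symm⟩
  have hj : h.choose = i := F₂.label_injective (h.choose_spec.trans (F₂.vert_openEnd i))
  simp only [glueSwap]
  rw [dif_pos h, hj]

lemma glueSwap_inl_of_notMem (F₁ F₂ : Fragment t) {d : F₁.D}
    (h : F₁.vert d ∉ Set.range F₁.label) : glueSwap F₁ F₂ (Sum.inl d) = Sum.inl d :=
  dif_neg h

lemma glueSwap_inr_of_notMem (F₁ F₂ : Fragment t) {d : F₂.D}
    (h : F₂.vert d ∉ Set.range F₂.label) : glueSwap F₁ F₂ (Sum.inr d) = Sum.inr d :=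
  dif_neg h

lemma card_ends_glue (F₁ F₂ : Fragment t) (q : Quot (GlueRel F₁ F₂)) :
    let edge : {d : F₁.D // F₁.vert d ∉ Set.range F₁.label} ⊕
        {d : F₂.D // F₂.vert d ∉ Set.range F₂.label} → Quot (GlueRel F₁ F₂) :=
      fun d => Quot.mk _ (Sum.map (fun d => F₁.edge d.1) (fun d => F₂.edge d.1) d)
    Nat.card {d // edge d = q} = 0 ∨ Nat.card {d // edge d = q} = 2 := by
  intro edge
  let e : F₁.D ⊕ F₂.D → F₁.E ⊕ F₂.E := Sum.map F₁.edge F₂.edge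
  have he : ∀ a, Nat.card {x // e x = a} = 0 ∨ Nat.card {x // e x = a} = 2 := by
    rintro (a | a)
    · rw [Nat.card_congr (β := {d // F₁.edge d = a})]
      · exact F₁.card_ends a
      · exact ⟨fun x => match x with
            | ⟨Sum.inl d, h⟩ => ⟨d, Sum.inl_injective h⟩
            | ⟨Sum.inr d, h⟩ => absurd h Sum.inr_ne_inl,
          fun x => ⟨Sum.inl x.1, congrArg Sum.inl x.2⟩,
          by
            rintro ⟨d | d, h⟩
            · rfl
            · exact absurd h Sum.inr_ne_inl,
          fun x => rfl⟩
    · rw [Nat.card_congr (β := {d // F₂.edge d = a})]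
      · exact F₂.card_ends a
      · exact ⟨fun x => match x with
            | ⟨Sum.inr d, h⟩ => ⟨d, Sum.inr_injective h⟩
            | ⟨Sum.inl d, h⟩ => absurd h Sum.inl_ne_inr,
          fun x => ⟨Sum.inr x.1, congrArg Sum.inr x.2⟩,
          by
            rintro ⟨d | d, h⟩
            · exact absurd h Sum.inl_ne_inr
            · rfl,
          fun x => rfl⟩
  have hlab : ∀ x, glueSwap F₁ F₂ x = x ∨
      (∃ i, x = Sum.inl (F₁.openEnd i)) ∨ ∃ i, x = Sum.inr (F₂.openEnd i) := by
    rintro (d | d)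
    · by_cases h : F₁.vert d ∈ Set.range F₁.label
      · obtain ⟨i, hi⟩ := h
        exact Or.inr (Or.inl ⟨i, congrArg Sum.inl (F₁.eq_openEnd hi.symm)⟩)
      · exact Or.inl (glueSwap_inl_of_notMem F₁ F₂ h)
    · by_cases h : F₂.vert d ∈ Set.range F₂.label
      · obtain ⟨i, hi⟩ := h
        exact Or.inr (Or.inr ⟨i, congrArg Sum.inr (F₂.eq_openEnd hi.symm)⟩)
      · exact Or.inl (glueSwap_inr_of_notMem F₁ F₂ h)
  have hinv : Function.Involutive (glueSwap F₁ F₂) := by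
    intro x
    rcases hlab x with h | ⟨i, rfl⟩ | ⟨i, rfl⟩
    · rw [h, h]
    · rw [glueSwap_inl_openEnd, glueSwap_inr_openEnd]
    · rw [glueSwap_inr_openEnd, glueSwap_inl_openEnd]
  have main := card_free_eq e he (glueSwap F₁ F₂) hinv (GlueRel F₁ F₂)
    (by
      rintro a b ⟨i, rfl, rfl⟩
      exact ⟨Sum.inl (F₁.openEnd i), rfl, by rw [glueSwap_inl_openEnd]; rfl⟩)
    (by
      intro x
      rcases hlab x with h | ⟨i, rfl⟩ | ⟨i, rfl⟩
      · rw [h]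
      · rw [glueSwap_inl_openEnd]
        exact (Quot.sound ⟨i, rfl, rfl⟩).symm
      · rw [glueSwap_inr_openEnd]
        exact Quot.sound ⟨i, rfl, rfl⟩) q
  have hfix1 : ∀ d : F₁.D, glueSwap F₁ F₂ (Sum.inl d) = Sum.inl d →
      F₁.vert d ∉ Set.range F₁.label := by
    rintro d h ⟨i, hi⟩
    rw [F₁.eq_openEnd hi.symm, glueSwap_inl_openEnd] at h
    exact Sum.inr_ne_inl h
  have hfix2 : ∀ d : F₂.D, glueSwap F₁ F₂ (Sum.inr d) = Sum.inr d →
      F₂.vert d ∉ Set.range F₂.label := by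
    rintro d h ⟨i, hi⟩
    rw [F₂.eq_openEnd hi.symm, glueSwap_inr_openEnd] at h
    exact Sum.inl_ne_inr h
  have hcard : Nat.card {d // edge d = q} =
      Nat.card {x // glueSwap F₁ F₂ x = x ∧ Quot.mk (GlueRel F₁ F₂) (e x) = q} := by
    refine Nat.card_eq_of_bijective
      (fun d => ⟨Sum.map Subtype.val Subtype.val d.1, ?_, ?_⟩) ⟨?_, ?_⟩
    · obtain ⟨d | d, h⟩ := d
      · exact glueSwap_inl_of_notMem F₁ F₂ d.2
      · exact glueSwap_inr_of_notMem F₁ F₂ d.2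
    · obtain ⟨d | d, h⟩ := d
      · exact h
      · exact h
    · intro a b h
      have h' := congrArg Subtype.val h
      exact Subtype.ext
        (Function.Injective.sumMap Subtype.val_injective Subtype.val_injective h')
    · rintro ⟨d | d, h1, h2⟩
      · exact ⟨⟨Sum.inl ⟨d, hfix1 d h1⟩, h2⟩, rfl⟩
      · exact ⟨⟨Sum.inr ⟨d, hfix2 d h1⟩, h2⟩, rfl⟩
  rw [hcard]
  exact main

/-- The graph `F₁ * F₂`: in the disjoint union of `F₁` and `F₂`, the labelled vertices (with the
half-edges at them) are removed and the open ends with the same label are glued together, i.e.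
the edges that carry them become one edge. A chain of glued edges that closes up is a circle. -/
def glue (F₁ F₂ : Fragment t) : Multigraph where
  V := {v : F₁.V // v ∉ Set.range F₁.label} ⊕ {v : F₂.V // v ∉ Set.range F₂.label}
  E := Quot (GlueRel F₁ F₂)
  D := {d : F₁.D // F₁.vert d ∉ Set.range F₁.label} ⊕
    {d : F₂.D // F₂.vert d ∉ Set.range F₂.label}
  finite_V := inferInstance
  finite_E := inferInstance
  finite_D := inferInstance
  vert := Sum.map (fun d => ⟨F₁.vert d.1, d.2⟩) (fun d => ⟨F₂.vert d.1, d.2⟩)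
  edge := fun d => Quot.mk _ (Sum.map (fun d => F₁.edge d.1) (fun d => F₂.edge d.1) d)
  card_ends := card_ends_glue F₁ F₂

end Fragment

/-- The `t`-th edge-connection matrix of the graph parameter `f`. -/
def edgeConnectionMatrix (f : Multigraph → ℂ) (t : ℕ) : Matrix (Fragment t) (Fragment t) ℂ :=
  Matrix.of fun F₁ F₂ => f (F₁.glue F₂)

/-- `f` has exponentially bounded edge-connection rank, i.e. finite edge-rank connectivity. -/
def HasFiniteEdgeRankConnectivity (f : Multigraph → ℂ) : Prop :=
  ∃ r : ℝ, 0 < r ∧ ∀ t : ℕ, ∃ n : ℕ, (edgeConnectionMatrix f t).eRank = n ∧ (n : ℝ) ≤ r ^ t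

/-! ### Eulerian orientations and local pairings -/

namespace Multigraph

variable {G : Multigraph}

/-- The half-edges of the subgraph `G(F)`. -/
abbrev HalfEdge (F : Set G.E) : Type := {d : G.D // G.edge d ∈ F}

/-- The edge of `F` to which a half-edge of `G(F)` belongs. -/
def HalfEdge.toEdge {F : Set G.E} (a : HalfEdge F) : F := ⟨G.edge a.1, a.2⟩

/-- The vertex to which a half-edge of `G(F)` is attached. -/
def HalfEdge.toVert {F : Set G.E} (a : HalfEdge F) : G.V := G.vert a.1

/-- `F` is Eulerian: every vertex has even degree in `G(F)`. -/
def IsEulerian (F : Set G.E) : Prop :=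
  ∀ v : G.V, Even (Nat.card {a : HalfEdge F // a.toVert = v})

/-- An orientation of the edges of `G(F)`, given by the set of half-edges that are incoming at
their vertex: of the two half-edges of an edge exactly one is incoming, the other one is outgoing.
(The direction of a circle plays no role and is not recorded.) -/
structure Orientation (F : Set G.E) where
  incoming : Set (HalfEdge F)
  opposite : ∀ a b : HalfEdge F, a ≠ b → a.toEdge = b.toEdge → (a ∈ incoming ↔ b ∉ incoming)

/-- An orientation is Eulerian if at every vertex the indegree equals the outdegree. -/
def Orientation.IsEulerian {F : Set G.E} (ω : Orientation F) : Prop :=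
  ∀ v : G.V, Nat.card {a : HalfEdge F // a.toVert = v ∧ a ∈ ω.incoming} =
    Nat.card {a : HalfEdge F // a.toVert = v ∧ a ∉ ω.incoming}

/-- A local pairing of `G(F)`: at each vertex a decomposition of the half-edges at this vertex
into ordered pairs. -/
structure LocalPairing (F : Set G.E) where
  pairs : G.V → Finset (HalfEdge F × HalfEdge F)
  mem_vert : ∀ v, ∀ p ∈ pairs v, p.1.toVert = v ∧ p.2.toVert = v
  ne : ∀ v, ∀ p ∈ pairs v, p.1 ≠ p.2
  existsUnique : ∀ a : HalfEdge F, ∃! p, p ∈ pairs a.toVert ∧ (p.1 = a ∨ p.2 = a)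

/-- `κ` is compatible with `ω` if in each pair of `κ` the first member is incoming and the second
one outgoing. -/
def LocalPairing.Compatible {F : Set G.E} (κ : LocalPairing F) (ω : Orientation F) : Prop :=
  ∀ v, ∀ p ∈ κ.pairs v, p.1 ∈ ω.incoming ∧ p.2 ∉ ω.incoming

/-- Two edges of `F` are consecutive if they have half-edges that are paired at a vertex. -/
def LocalPairing.Consecutive {F : Set G.E} (κ : LocalPairing F) (x y : F) : Prop :=
  ∃ v, ∃ p ∈ κ.pairs v, p.1.toEdge = x ∧ p.2.toEdge = y

/-- The number `c(κ)` of circuits into which `κ` decomposes `F`: the number of classes of the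
equivalence relation generated by consecutiveness. Each circle in `F` is a circuit of its own. -/
def LocalPairing.numCircuits {F : Set G.E} (κ : LocalPairing F) : ℕ :=
  Nat.card (Quot κ.Consecutive)

/-- A finite type with an even number of elements has a fixed-point-free involution. -/
lemma exists_fpf_involution {X : Type} [Finite X] (h : Even (Nat.card X)) :
    ∃ τ : X → X, Function.Involutive τ ∧ ∀ x, τ x ≠ x := by
  obtain ⟨m, hm⟩ := h
  have hc : Nat.card X = Nat.card (Fin m × Bool) := by simp; omega
  have := Fintype.ofFinite X
  let e : X ≃ Fin m × Bool :=
    Fintype.equivOfCardEq (by rw [← Nat.card_eq_fintype_card, hc, Nat.card_eq_fintype_card])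
  refine ⟨fun x => e.symm ((e x).1, !(e x).2), fun x => by simp, fun x hx => ?_⟩
  have := congrArg e hx
  simp only [Equiv.apply_symm_apply] at this
  have := congrArg Prod.snd this
  simp at this

/-- An Eulerian `F` has an Eulerian orientation with a compatible local pairing. -/
lemma exists_compatible {F : Set G.E} (hF : IsEulerian F) :
    ∃ κ : LocalPairing F, ∃ ω : Orientation F, ω.IsEulerian ∧ κ.Compatible ω := by
  classical
  choose τ hτ hτ' using fun v => exists_fpf_involution (hF v)
  let τ' : HalfEdge F → HalfEdge F := fun a => (τ a.toVert ⟨a, rfl⟩).1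
  have hτv : ∀ v (x : {a : HalfEdge F // a.toVert = v}), τ' x.1 = (τ v x).1 := by
    rintro v ⟨a, rfl⟩; rfl
  have hvert : ∀ a, (τ' a).toVert = a.toVert := fun a => (τ a.toVert ⟨a, rfl⟩).2
  have hinv : Function.Involutive τ' := by
    intro a
    rw [show τ' a = (τ a.toVert ⟨a, rfl⟩).1 from rfl, hτv, hτ]
  have hne : ∀ a, τ' a ≠ a := fun a h => hτ' _ ⟨a, rfl⟩ (Subtype.ext h)
  have he : ∀ x : F, Nat.card {a : HalfEdge F // a.toEdge = x} = 0 ∨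
      Nat.card {a : HalfEdge F // a.toEdge = x} = 2 := by
    intro x
    rw [Nat.card_congr (β := {d // G.edge d = x.1})]
    · exact G.card_ends x.1
    · exact ⟨fun a => ⟨a.1.1, congrArg Subtype.val a.2⟩,
        fun d => ⟨⟨d.1, by rw [d.2]; exact x.2⟩, Subtype.ext d.2⟩, fun _ => rfl, fun _ => rfl⟩
  obtain ⟨σ, hσ, hσ', heσ, hσe⟩ := exists_partner (HalfEdge.toEdge (F := F)) he
  obtain ⟨c, hc⟩ := exists_two_coloring σ τ' hσ hinv hσ' hne
  refine ⟨⟨fun v => Finset.univ.filter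
    fun p => p.1.toVert = v ∧ p.1 ∈ c ∧ p.2 = τ' p.1, ?_, ?_, ?_⟩, ⟨c, ?_⟩, ?_, ?_⟩
  · intro v p hp
    obtain ⟨h1, -, h3⟩ := (Finset.mem_filter.1 hp).2
    exact ⟨h1, by rw [h3, hvert, h1]⟩
  · intro v p hp h
    obtain ⟨-, -, h3⟩ := (Finset.mem_filter.1 hp).2
    exact hne p.1 (h3.symm.trans h.symm)
  · intro a
    by_cases ha : a ∈ c
    · refine ⟨(a, τ' a), ⟨Finset.mem_filter.2 ⟨Finset.mem_univ _, rfl, ha, rfl⟩, Or.inl rfl⟩, ?_⟩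
      rintro ⟨x, y⟩ ⟨hp, hx⟩
      obtain ⟨-, h2, h3⟩ := (Finset.mem_filter.1 hp).2
      dsimp only at h2 h3 hx
      rcases hx with rfl | rfl
      · rw [h3]
      · rw [h3] at ha
        exact absurd h2 ((hc x).2.1 ha)
    · refine ⟨(τ' a, a), ⟨Finset.mem_filter.2 ⟨Finset.mem_univ _, hvert a, (hc a).2.2 ha,
        (hinv a).symm⟩, Or.inr rfl⟩, ?_⟩
      rintro ⟨x, y⟩ ⟨hp, hx⟩
      obtain ⟨-, h2, h3⟩ := (Finset.mem_filter.1 hp).2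
      dsimp only at h2 h3 hx
      rcases hx with rfl | rfl
      · exact absurd h2 ha
      · rw [h3, hinv]
  · intro a b hab h
    rcases hσe a b h.symm with h' | h'
    · exact absurd h'.symm hab
    · rw [h', (hc a).1, not_not]
  · intro v
    refine Nat.card_congr ⟨fun a => ⟨τ' a.1, (hvert _).trans a.2.1, fun h => (hc _).2.1 h a.2.2⟩,
      fun a => ⟨τ' a.1, (hvert _).trans a.2.1, (hc _).2.2 a.2.2⟩, fun a => ?_, fun a => ?_⟩
    · exact Subtype.ext (hinv _)
    · exact Subtype.ext (hinv _)
  · intro v p hp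
    obtain ⟨-, h2, h3⟩ := (Finset.mem_filter.1 hp).2
    refine ⟨h2, fun h => ?_⟩
    change p.2 ∈ c at h
    rw [h3, (hc _).2] at h
    exact h h2

end Multigraph

/-! ### Mixed partition functions -/

/-- The space `V_n = ℂ^n`. -/
abbrev Vec (n : ℕ) : Type := Fin n → ℂ

/-- The standard basis vector of index `i` of `V_n`. -/
def basisVec {n : ℕ} (i : Fin n) : Vec n := Pi.single i 1

/-- The vector `g_i`; in terms of indices that start at `0`, it is `-f_{i+ℓ}` if `i < ℓ`, and
`f_{i-ℓ}` if `i ≥ ℓ`. -/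
def dualVec {ℓ : ℕ} (i : Fin (2 * ℓ)) : Vec (2 * ℓ) :=
  if h : (i : ℕ) < ℓ then -basisVec ⟨i + ℓ, by omega⟩
  else basisVec ⟨i - ℓ, by omega⟩

/-- A `(k,2ℓ)`-color edge coloring model: an element of `(S V_k ⊗ ⋀ V_{2ℓ})^*`. -/
abbrev EdgeColoringModel (k ℓ : ℕ) : Type :=
  Module.Dual ℂ (SymmetricAlgebra ℂ (Vec k) ⊗[ℂ] ExteriorAlgebra ℂ (Vec (2 * ℓ)))

/-- The element `x ∧ y` of the exterior algebra. -/
def wedgePair {n : ℕ} (x y : Vec n) : ExteriorAlgebra ℂ (Vec n) :=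
  ExteriorAlgebra.ι ℂ x * ExteriorAlgebra.ι ℂ y

lemma commute_wedgePair {n : ℕ} (x y z w : Vec n) : Commute (wedgePair x y) (wedgePair z w) := by
  have anti : ∀ a b : Vec n, ExteriorAlgebra.ι ℂ a * ExteriorAlgebra.ι ℂ b =
      -(ExteriorAlgebra.ι ℂ b * ExteriorAlgebra.ι ℂ a) := fun a b =>
    eq_neg_of_add_eq_zero_left (ExteriorAlgebra.ι_add_mul_swap a b)
  have h : ∀ a : Vec n, Commute (wedgePair x y) (ExteriorAlgebra.ι ℂ a) := by
    intro a
    change wedgePair x y * _ = _ * wedgePair x y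
    unfold wedgePair
    rw [mul_assoc, anti y a, mul_neg, ← mul_assoc, anti x a, neg_mul, neg_neg, mul_assoc]
  exact (h z).mul_right (h w)

section PartitionFunction

open Classical in
/-- The element `⨀_{a ∈ δ_{E∖F}(v)} e_{ψ(a)}` of `S V_k`; a loop at `v` contributes twice. -/
def symAt {G : Multigraph} {k : ℕ} {F : Set G.E} (ψ : (Fᶜ : Set G.E) → Fin k) (v : G.V) :
    SymmetricAlgebra ℂ (Vec k) :=
  ∏ a : {a : Multigraph.HalfEdge Fᶜ // a.toVert = v},
    SymmetricAlgebra.ι ℂ (Vec k) (basisVec (ψ a.1.toEdge))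

/-- The element `⋀_{(a₁,a₂) ∈ κ_v} f_{φ(a₁)} ∧ g_{φ(a₂)}` of `⋀ V_{2ℓ}`. The factors for the
different pairs commute, so no order of the pairs is needed. -/
def wedgeAt {G : Multigraph} {ℓ : ℕ} {F : Set G.E} (κ : Multigraph.LocalPairing F)
    (φ : F → Fin (2 * ℓ)) (v : G.V) : ExteriorAlgebra ℂ (Vec (2 * ℓ)) :=
  (κ.pairs v).noncommProd
    (fun p => wedgePair (basisVec (φ p.1.toEdge)) (dualVec (φ p.2.toEdge)))
    (fun _ _ _ _ _ => commute_wedgePair _ _ _ _)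

open Classical in
/-- The number `s_h(G, F, ω, κ)` for a local pairing `κ` of `G(F)`; the orientation `ω` enters
only through the requirement that `κ` be compatible with it. -/
def partialValue {k ℓ : ℕ} (h : EdgeColoringModel k ℓ) {G : Multigraph} {F : Set G.E}
    (κ : Multigraph.LocalPairing F) : ℂ :=
  (-1) ^ κ.numCircuits *
    ∑ φ : F → Fin (2 * ℓ), ∑ ψ : (Fᶜ : Set G.E) → Fin k,
      ∏ v : G.V, h (symAt ψ v ⊗ₜ[ℂ] wedgeAt κ φ v)

/-- The number `s_h(G, F)` for an Eulerian set `F`: the value of `s_h(G, F, ω, κ)` for an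
arbitrary Eulerian orientation `ω` of `G(F)` and an arbitrary compatible local pairing `κ`. -/
def eulerianValue {k ℓ : ℕ} (h : EdgeColoringModel k ℓ) {G : Multigraph} {F : Set G.E}
    (hF : Multigraph.IsEulerian F) : ℂ :=
  partialValue h (Multigraph.exists_compatible hF).choose

open Classical in
/-- The mixed partition function `p_h`. -/
def partitionFunction {k ℓ : ℕ} (h : EdgeColoringModel k ℓ) (G : Multigraph) : ℂ :=
  ∑ F : {F : Set G.E // Multigraph.IsEulerian F}, eulerianValue h F.2

end PartitionFunction

end MixedPartition

end

open scoped TensorProduct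

noncomputable section

namespace MixedPartition

/-! ### Orbits and signs of permutations -/

/-! Let V be the superspace with k even and 2ℓ odd coordinates. Each `t`-fragment has a vector in
the `t`-th tensor power of V, of dimension (k + 2ℓ)^t, and p_h(F₁ * F₂) is a bilinear form in the
vectors of F₁ and F₂ (`Fragment.partitionFunction_glue`). The connection matrix therefore factors
through that space. The difficulty is the sign (-1)^c(κ): it is a global quantity of the glued graph
and has to be distributed over the two fragments.

Treat every half-edge of F₁ ∪ F₂ as an anticommuting generator, and give the two half-edges of an
edge conjugate colours. Since g_i is ± the vector of the conjugate of i, an odd edge with half-edges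
d, d' contributes ± d ∧ d'. Reversing the edge changes both this sign and the wedge, so the product
over odd edges needs no Eulerian orientation and splits into a factor for F₁ and one for F₂. The
product over the pairs of κ, together with the pairs of glued open ends, splits over vertices and
labels instead, and it uses the same generators.

The two products differ by the sign of the permutation π that sends a pair to the next pair along
its circuit (`prod_evenPair_perm`). On the edges of F₁ ∪ F₂ the orbits of π are the circuits, whence
(-1)^c(κ) = sign π · (-1)^(number of odd edges) (`Fragment.neg_one_pow_numCircuits`), and the
exponent is additive over the fragments. Comparing coefficients of a nonzero monomial
(`sign_mul_edgeScalar`) then replaces sign π by scalars that belong to one fragment, one vertex or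
the labels. Each term thus becomes a product of two weights and a sign that depends only on the
colours at the labels (`value_eq`). A bijection between colourings of F₁ * F₂ and matching pairs of
colourings (`partialValue_eq`) finishes the argument. -/

lemma card_eq_of_same_kernel {α β γ : Type*} (f : α → β) (g : α → γ)
    (hf : Function.Surjective f) (hg : Function.Surjective g)
    (h : ∀ a b, f a = f b ↔ g a = g b) : Nat.card β = Nat.card γ := by
  refine Nat.card_congr (Equiv.ofBijective (fun b => g (Function.surjInv hf b)) ⟨?_, ?_⟩)
  · intro b b' hb
    have := (h _ _).2 hb
    rwa [Function.surjInv_eq hf, Function.surjInv_eq hf] at this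
  · intro c
    obtain ⟨a, rfl⟩ := hg c
    refine ⟨f a, (h _ _).1 ?_⟩
    rw [Function.surjInv_eq hf]

/-- A permutation of `n` elements with `m` orbits has sign `(-1) ^ (n + m)`. -/
lemma neg_one_pow_card_orbits {α β : Type*} [Fintype α] [DecidableEq α]
    (π : Equiv.Perm α) (g : α → β) (hg : Function.Surjective g)
    (h : ∀ a b, g a = g b ↔ π.SameCycle a b) :
    (-1 : ℂ) ^ Nat.card β = ((Equiv.Perm.sign π : ℤ) : ℂ) * (-1) ^ Fintype.card α := by
  -- An orbit is either the support of a nontrivial cycle or a fixed point, and `f` records which.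
  -- The number of orbits is thereby expressed through the cycle type, which also determines the
  -- sign.
  let f : α → π.cycleFactorsFinset ⊕ {x // x ∉ π.support} := fun x =>
    if hx : x ∈ π.support then
      Sum.inl ⟨π.cycleOf x, Equiv.Perm.cycleOf_mem_cycleFactorsFinset_iff.2 hx⟩
    else Sum.inr ⟨x, hx⟩
  have hf : Function.Surjective f := by
    rintro (⟨c, hc⟩ | ⟨x, hx⟩)
    · obtain ⟨a, ha⟩ := (Equiv.Perm.mem_cycleFactorsFinset_iff.1 hc).1.nonempty_support
      have hcy := Equiv.Perm.cycle_is_cycleOf ha hc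
      have has : a ∈ π.support := Equiv.Perm.mem_cycleFactorsFinset_support_le hc ha
      refine ⟨a, ?_⟩
      simp only [f, dif_pos has]
      exact congrArg Sum.inl (Subtype.ext hcy.symm)
    · exact ⟨x, by simp only [f, dif_neg hx]⟩
  have hfk : ∀ a b, f a = f b ↔ π.SameCycle a b := by
    intro a b
    by_cases ha : a ∈ π.support <;> by_cases hb : b ∈ π.support
    · simp only [f, dif_pos ha, dif_pos hb, Sum.inl.injEq, Subtype.mk.injEq]
      refine ⟨fun hab => ?_, fun hab => hab.cycleOf_eq⟩
      have : b ∈ (π.cycleOf b).support :=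
        Equiv.Perm.mem_support_cycleOf_iff.2 ⟨Equiv.Perm.SameCycle.refl _ _, hb⟩
      rw [← hab] at this
      exact (Equiv.Perm.mem_support_cycleOf_iff.1 this).1
    · simp only [f, dif_pos ha, dif_neg hb, reduceCtorEq, false_iff]
      intro hab
      rw [Equiv.Perm.notMem_support] at hb
      have := hab.eq_of_right hb
      rw [this] at ha
      exact Equiv.Perm.mem_support.1 ha hb
    · simp only [f, dif_neg ha, dif_pos hb, reduceCtorEq, false_iff]
      intro hab
      rw [Equiv.Perm.notMem_support] at ha
      have := hab.eq_of_left ha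
      rw [← this] at hb
      exact Equiv.Perm.mem_support.1 hb ha
    · simp only [f, dif_neg ha, dif_neg hb, Sum.inr.injEq, Subtype.mk.injEq]
      refine ⟨fun hab => hab ▸ Equiv.Perm.SameCycle.refl _ _, fun hab => ?_⟩
      exact hab.eq_of_left (Equiv.Perm.notMem_support.1 ha)
  have hcard := card_eq_of_same_kernel g f hg hf (fun a b => (h a b).trans (hfk a b).symm)
  have h1 : Nat.card {x // x ∉ π.support} + π.support.card = Fintype.card α := by
    rw [Nat.card_eq_fintype_card, Fintype.card_subtype_compl, Fintype.card_coe]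
    have := Finset.card_le_univ π.support
    omega
  rw [hcard, Nat.card_sum, Equiv.Perm.sign_of_cycleType, Equiv.Perm.sum_cycleType,
    Equiv.Perm.cycleType_def, Multiset.card_map]
  simp only [Nat.card_eq_fintype_card, Fintype.card_coe] at h1 ⊢
  rw [← h1]
  push_cast
  have h2 : ((-1 : ℂ) ^ π.support.card) * (-1) ^ π.support.card = 1 := by
    rw [← mul_pow]; norm_num
  change _ = (-1 : ℂ) ^ (_ + π.cycleFactorsFinset.card) * _
  rw [pow_add, pow_add, pow_add]
  linear_combination (-(-1 : ℂ) ^ π.cycleFactorsFinset.card *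
    (-1) ^ (Fintype.card { x // x ∉ π.support })) * h2

/-! ### Pairs and monomials in exterior algebras -/

section Exterior

variable {M : Type} [AddCommGroup M] [Module ℂ M]

lemma ι_mul_ι_anticomm (x y : M) : ExteriorAlgebra.ι ℂ x * ExteriorAlgebra.ι ℂ y =
    -(ExteriorAlgebra.ι ℂ y * ExteriorAlgebra.ι ℂ x) :=
  eq_neg_of_add_eq_zero_left (ExteriorAlgebra.ι_add_mul_swap x y)

lemma ι_mul_ι_mem_center (x y : M) : ExteriorAlgebra.ι ℂ x * ExteriorAlgebra.ι ℂ y ∈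
    Subalgebra.center ℂ (ExteriorAlgebra ℂ M) := by
  rw [Subalgebra.mem_center_iff]
  intro b
  induction b using ExteriorAlgebra.induction with
  | algebraMap r => exact Algebra.commutes _ _
  | ι z =>
    rw [← mul_assoc, ι_mul_ι_anticomm z x, neg_mul, mul_assoc, ι_mul_ι_anticomm z y, mul_neg,
      neg_neg, mul_assoc]
  | mul a b ha hb => rw [mul_assoc, hb, ← mul_assoc, ha, mul_assoc]
  | add a b ha hb => rw [add_mul, mul_add, ha, hb]

/-- The central element `x ∧ y` of the exterior algebra. -/
def evenPair (x y : M) : Subalgebra.center ℂ (ExteriorAlgebra ℂ M) :=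
  ⟨ExteriorAlgebra.ι ℂ x * ExteriorAlgebra.ι ℂ y, ι_mul_ι_mem_center x y⟩

lemma evenPair_swap (x y : M) : evenPair x y = -evenPair y x :=
  Subtype.ext (ι_mul_ι_anticomm x y)

lemma evenPair_mul_evenPair (a b a' b' : M) :
    evenPair a b' * evenPair a' b = -(evenPair a b * evenPair a' b') := by
  apply Subtype.ext
  change ExteriorAlgebra.ι ℂ a * ExteriorAlgebra.ι ℂ b' *
    (ExteriorAlgebra.ι ℂ a' * ExteriorAlgebra.ι ℂ b) = -(ExteriorAlgebra.ι ℂ a *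
      ExteriorAlgebra.ι ℂ b * (ExteriorAlgebra.ι ℂ a' * ExteriorAlgebra.ι ℂ b'))
  have h := Subalgebra.mem_center_iff.1 (ι_mul_ι_mem_center a' b) (ExteriorAlgebra.ι ℂ b')
  have h' := Subalgebra.mem_center_iff.1 (ι_mul_ι_mem_center a' b') (ExteriorAlgebra.ι ℂ b)
  rw [mul_assoc, mul_assoc, h, h', mul_assoc, mul_assoc, ι_mul_ι_anticomm b b', mul_neg, mul_neg]

lemma prod_evenPair_swap {J : Type*} [Fintype J] [DecidableEq J] {x y : J} (hxy : x ≠ y)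
    (u t : J → M) : ∏ j, evenPair (u j) (t (Equiv.swap x y j)) =
      -∏ j, evenPair (u j) (t j) := by
  have hy : y ∈ Finset.univ.erase x := by simp [hxy.symm]
  rw [← Finset.mul_prod_erase _ _ (Finset.mem_univ x), ← Finset.mul_prod_erase _ _ hy,
    ← Finset.mul_prod_erase _ (fun j => evenPair (u j) (t j)) (Finset.mem_univ x),
    ← Finset.mul_prod_erase _ (fun j => evenPair (u j) (t j)) hy,
    Equiv.swap_apply_left, Equiv.swap_apply_right, ← mul_assoc, ← mul_assoc,
    evenPair_mul_evenPair]
  refine (neg_mul _ _).trans (congrArg _ (congrArg _ ?_))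
  refine Finset.prod_congr rfl fun j hj => ?_
  simp only [Finset.mem_erase] at hj
  rw [Equiv.swap_apply_of_ne_of_ne hj.2.1 hj.1]

/-- A transposition of the second entries of two pairs costs one sign, by `evenPair_mul_evenPair`,
and transpositions generate. The pairs themselves commute, so no order of them matters. This is
where the sign of π enters. -/
lemma prod_evenPair_perm {J : Type*} [Fintype J] [DecidableEq J] (π : Equiv.Perm J)
    (u t : J → M) : ∏ j, evenPair (u j) (t (π j)) =
      ((Equiv.Perm.sign π : ℤ) : ℂ) • ∏ j, evenPair (u j) (t j) := by
  induction π using Equiv.Perm.swap_induction_on generalizing t with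
  | one => simp
  | swap_mul f x y hxy ih =>
    have := ih (fun j => t (Equiv.swap x y j))
    simp only [Equiv.Perm.mul_apply]
    rw [this, prod_evenPair_swap hxy, Equiv.Perm.sign_mul, Equiv.Perm.sign_swap hxy]
    simp

end Exterior

/-- The Grassmann algebra with generators indexed by `X`. -/
abbrev Grassmann (X : Type) : Type := ExteriorAlgebra ℂ (X →₀ ℂ)

section Grassmann

variable {X : Type}

/-- The vector spanning the generator of index `x`. -/
def gen (x : X) : X →₀ ℂ := Finsupp.single x 1

/-- The product of the generators in a list. -/
def mon (l : List X) : Grassmann X := (l.map fun x => ExteriorAlgebra.ι ℂ (gen x)).prod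

@[simp] lemma mon_nil : mon ([] : List X) = 1 := rfl

lemma mon_cons (x : X) (l : List X) : mon (x :: l) = ExteriorAlgebra.ι ℂ (gen x) * mon l := by
  simp [mon]

lemma mon_append (l l' : List X) : mon (l ++ l') = mon l * mon l' := by
  simp [mon]

/-- The scalar is a sign, but its value is never needed: unknown scalars are later related to each
other by comparing coefficients. -/
lemma mon_perm {l l' : List X} (h : l.Perm l') : ∃ s : ℂ, mon l = s • mon l' := by
  induction h with
  | nil => exact ⟨1, by simp⟩
  | cons x _ ih =>
    obtain ⟨s, hs⟩ := ih
    exact ⟨s, by rw [mon_cons, mon_cons, hs, mul_smul_comm]⟩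
  | swap x y l =>
    refine ⟨-1, ?_⟩
    simp only [mon_cons, ← mul_assoc]
    rw [ι_mul_ι_anticomm]
    simp
  | trans _ _ ih ih' =>
    obtain ⟨s, hs⟩ := ih
    obtain ⟨s', hs'⟩ := ih'
    exact ⟨s * s', by rw [hs, hs', smul_smul]⟩

lemma mon_perm_of_mem_iff {l l' : List X} (hl : l.Nodup) (hl' : l'.Nodup)
    (h : ∀ x, x ∈ l ↔ x ∈ l') : ∃ s : ℂ, mon l = s • mon l' :=
  mon_perm ((List.perm_ext_iff_of_nodup hl hl').2 h)

/-- The coordinate determinant of the listed generators is an alternating form that takes the value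
1 on them, so their product cannot vanish. This makes the comparison of coefficients legitimate. -/
lemma mon_ne_zero {l : List X} (hl : l.Nodup) : mon l ≠ 0 := by
  let A : (X →₀ ℂ) [⋀^Fin l.length]→ₗ[ℂ] ℂ :=
    (Matrix.detRowAlternating (R := ℂ) (n := Fin l.length)).compLinearMap
      (LinearMap.pi fun i => Finsupp.lapply (l.get i))
  have h1 : mon l = ExteriorAlgebra.ιMulti ℂ l.length (fun i => gen (l.get i)) := by
    rw [ExteriorAlgebra.ιMulti_apply, mon]
    congr 1
    conv_lhs => rw [← List.ofFn_get l, List.map_ofFn]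
    rfl
  intro h0
  have h2 := ExteriorAlgebra.liftAlternating_apply_ιMulti (R := ℂ)
    (Function.update (fun _ => 0) l.length A) (fun i => gen (l.get i))
  rw [← h1, h0, map_zero, Function.update_self] at h2
  have h3 : A (fun i => gen (l.get i)) = 1 := by
    change Matrix.det (fun i j => gen (l.get i) (l.get j)) = 1
    rw [← Matrix.det_one (n := Fin l.length)]
    congr 1
    funext i j
    classical
    rw [gen, Finsupp.single_apply, Matrix.one_apply]
    simp only [hl.injective_get.eq_iff]
  rw [h3] at h2
  exact zero_ne_one h2

/-- The algebra homomorphism from a Grassmann algebra that sends the generator of index `x`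
to `v x`. -/
def grassmannHom {M : Type} [AddCommGroup M] [Module ℂ M] (v : X → M) :
    Grassmann X →ₐ[ℂ] ExteriorAlgebra ℂ M :=
  ExteriorAlgebra.map (Finsupp.linearCombination ℂ v)

section Hom

variable {M : Type} [AddCommGroup M] [Module ℂ M] (v : X → M)

@[simp] lemma grassmannHom_ι_gen (x : X) :
    grassmannHom v (ExteriorAlgebra.ι ℂ (gen x)) = ExteriorAlgebra.ι ℂ (v x) := by
  simp [grassmannHom, gen]

lemma grassmannHom_mon (l : List X) :
    grassmannHom v (mon l) = (l.map fun x => ExteriorAlgebra.ι ℂ (v x)).prod := by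
  rw [mon, map_list_prod, List.map_map]
  congr 1
  refine List.map_congr_left fun x _ => ?_
  simp

lemma grassmannHom_evenPair (x y : X) :
    grassmannHom v (evenPair (gen x) (gen y) : Grassmann X) = evenPair (v x) (v y) := by
  simp [evenPair]

lemma grassmannHom_gen_mon {Y : Type} (f : X → Y) (l : List X) :
    grassmannHom (fun x => gen (f x)) (mon l) = mon (l.map f) := by
  rw [grassmannHom_mon, mon, List.map_map]
  rfl

end Hom

lemma ι_mul_mon (x : X) (l : List X) : ExteriorAlgebra.ι ℂ (gen x) * mon l =
    (-1 : ℂ) ^ l.length • (mon l * ExteriorAlgebra.ι ℂ (gen x)) := by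
  induction l with
  | nil => simp
  | cons y l ih =>
    rw [mon_cons, ← mul_assoc, ι_mul_ι_anticomm, neg_mul, mul_assoc, ih, List.length_cons,
      pow_succ, mul_smul_comm, mul_assoc]
    simp

lemma commute_mon_of_even {l : List X} (hl : Even l.length) (l' : List X) :
    mon l' * mon l = mon l * mon l' := by
  induction l' with
  | nil => simp
  | cons x l' ih =>
    rw [mon_cons, mul_assoc, ih, ← mul_assoc, ι_mul_mon, hl.neg_one_pow, one_smul, mul_assoc]

lemma coe_prod_evenPair {J : Type*} (A : Finset J) (f g : J → X) :
    ((∏ j ∈ A, evenPair (gen (f j)) (gen (g j)) :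
      Subalgebra.center ℂ (Grassmann X)) : Grassmann X) =
      mon (A.toList.flatMap fun j => [f j, g j]) := by
  rw [← Finset.prod_map_toList]
  induction A.toList with
  | nil => rfl
  | cons j l ih =>
    rw [List.map_cons, List.prod_cons, List.flatMap_cons, mon_append, ← ih]
    change _ * _ = _
    simp [mon_cons, evenPair]

/-- Moving the second entry of the first pair past the first entries of the other n pairs costs
(-1)^n, and n + C(n, 2) = C(n + 1, 2). -/
lemma coe_list_prod_evenPair {J : Type*} (l : List J) (f g : J → X) :
    (((l.map fun j => evenPair (gen (f j)) (gen (g j))).prod :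
      Subalgebra.center ℂ (Grassmann X)) : Grassmann X) =
      (-1 : ℂ) ^ (l.length.choose 2) • (mon (l.map f) * mon (l.map g)) := by
  induction l with
  | nil => simp
  | cons j l ih =>
    rw [List.map_cons, List.prod_cons]
    change _ * _ = _
    rw [ih, List.length_cons, Nat.choose_succ_succ' l.length 1, Nat.choose_one_right, pow_add]
    change ExteriorAlgebra.ι ℂ (gen (f j)) * ExteriorAlgebra.ι ℂ (gen (g j)) * _ = _
    rw [List.map_cons, List.map_cons, mon_cons, mon_cons, mul_smul_comm, mul_assoc,
      ← mul_assoc _ (mon _) (mon _), ι_mul_mon, List.length_map, smul_mul_assoc, mul_smul_comm, smul_smul,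
      mul_comm ((-1 : ℂ) ^ _)]
    simp only [mul_assoc]

end Grassmann

section Grassmann

variable {X Y J : Type}

lemma nodup_flatMap_pairs {A : Finset J} {f g : J → X}
    (hf : ∀ i ∈ A, ∀ j ∈ A, f i = f j → i = j) (hg : ∀ i ∈ A, ∀ j ∈ A, g i = g j → i = j)
    (hfg : ∀ i ∈ A, ∀ j ∈ A, f i ≠ g j) : (A.toList.flatMap fun j => [f j, g j]).Nodup := by
  rw [List.nodup_flatMap]
  constructor
  · intro j hj
    rw [Finset.mem_toList] at hj
    simpa using hfg j hj j hj
  · refine A.nodup_toList.imp_of_mem fun {i j} hi hj hij => ?_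
    rw [Finset.mem_toList] at hi hj
    intro x hx hx'
    simp only [List.mem_cons, List.not_mem_nil, or_false] at hx hx'
    rcases hx with rfl | rfl <;> rcases hx' with h | h
    · exact hij (hf _ hi _ hj h)
    · exact hfg _ hi _ hj h
    · exact hfg _ hj _ hi h.symm
    · exact hij (hg _ hi _ hj h)

lemma coe_prod_smul_evenPair (A : Finset J) (a : J → ℂ) (f g : J → X) :
    ((∏ j ∈ A, a j • evenPair (gen (f j)) (gen (g j)) :
      Subalgebra.center ℂ (Grassmann X)) : Grassmann X) =
      (∏ j ∈ A, a j) • mon (A.toList.flatMap fun j => [f j, g j]) := by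
  rw [← coe_prod_evenPair, Finset.prod_smul]
  rfl

/-- The pairs use each generator of `l` exactly once, so they multiply to a reordering of `mon l`.
-/
lemma exists_coe_prod_smul_evenPair (A : Finset J) (a : J → ℂ) {f g : J → X}
    (hf : ∀ i ∈ A, ∀ j ∈ A, f i = f j → i = j) (hg : ∀ i ∈ A, ∀ j ∈ A, g i = g j → i = j)
    (hfg : ∀ i ∈ A, ∀ j ∈ A, f i ≠ g j) {l : List X} (hl : l.Nodup)
    (hmem : ∀ x, x ∈ l ↔ ∃ j ∈ A, x = f j ∨ x = g j) :
    ∃ s : ℂ, ((∏ j ∈ A, a j • evenPair (gen (f j)) (gen (g j)) :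
      Subalgebra.center ℂ (Grassmann X)) : Grassmann X) = s • mon l := by
  obtain ⟨s, hs⟩ := mon_perm_of_mem_iff (nodup_flatMap_pairs hf hg hfg) hl (fun x => by
    rw [hmem]; simp)
  exact ⟨(∏ j ∈ A, a j) * s, by rw [coe_prod_smul_evenPair, hs, smul_smul]⟩

/-- An algebra homomorphism need not send the centre into the centre, so the product is transported
as a monomial. -/
lemma grassmannHom_gen_prod_smul_evenPair (A : Finset J) (a : J → ℂ) (f g : J → X) (r : X → Y) :
    grassmannHom (fun x => gen (r x)) ((∏ j ∈ A, a j • evenPair (gen (f j)) (gen (g j)) :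
      Subalgebra.center ℂ (Grassmann X)) : Grassmann X) =
      ((∏ j ∈ A, a j • evenPair (gen (r (f j))) (gen (r (g j))) :
        Subalgebra.center ℂ (Grassmann Y)) : Grassmann Y) := by
  rw [coe_prod_smul_evenPair, coe_prod_smul_evenPair A a (fun j => r (f j)), map_smul,
    grassmannHom_gen_mon, List.map_flatMap]
  rfl

end Grassmann

/-! ### Colours -/

/-- The colours: `k` even and `2ℓ` odd ones. -/
abbrev Color (k ℓ : ℕ) : Type := Fin k ⊕ Fin (2 * ℓ)

/-- The index `i + ℓ` or `i - ℓ`. -/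
def conjIndex {ℓ : ℕ} (i : Fin (2 * ℓ)) : Fin (2 * ℓ) :=
  if h : (i : ℕ) < ℓ then ⟨i + ℓ, by omega⟩ else ⟨i - ℓ, by omega⟩

namespace Color

variable {k ℓ : ℕ}

/-- Conjugation fixes the even colours and swaps the odd colours `i` and `i + ℓ`. -/
def conj : Color k ℓ → Color k ℓ := Sum.map id conjIndex

/-- The odd colours. -/
abbrev IsOdd (c : Color k ℓ) : Prop := c.isRight = true

/-- The sign in `g_i = ± f_{i ± ℓ}`. -/
def sgn : Color k ℓ → ℂ := Sum.elim (fun _ => 1) fun i => if (i : ℕ) < ℓ then -1 else 1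

/-- The contribution of a half-edge to the symmetric algebra. -/
def sym : Color k ℓ → SymmetricAlgebra ℂ (Vec k) :=
  Sum.elim (fun i => SymmetricAlgebra.ι ℂ (Vec k) (basisVec i)) fun _ => 1

/-- The vector of an odd colour. -/
def vec : Color k ℓ → Vec (2 * ℓ) := Sum.elim (fun _ => 0) basisVec

@[simp] lemma conj_conj (c : Color k ℓ) : c.conj.conj = c := by
  rcases c with i | i
  · rfl
  · simp only [conj, Sum.map_inr, Sum.inr.injEq]
    ext
    unfold conjIndex
    by_cases h : (i : ℕ) < ℓ
    · rw [dif_pos h, dif_neg (by simp)]; simp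
    · have := i.2
      rw [dif_neg h, dif_pos (by simp only; omega)]; simp only; omega

@[simp] lemma isRight_conj (c : Color k ℓ) : c.conj.isRight = c.isRight := by
  rcases c with i | i <;> rfl

/-- Together with `evenPair_swap`, this makes the contribution of an odd edge independent of its
direction. -/
lemma sgn_conj {c : Color k ℓ} (h : c.IsOdd) : c.conj.sgn = -c.sgn := by
  rcases c with i | i
  · exact absurd h (by simp)
  · simp only [conj, Sum.map_inr, sgn, Sum.elim_inr]
    unfold conjIndex
    by_cases h : (i : ℕ) < ℓ
    · rw [dif_pos h, if_pos h, if_neg (by simp)]; simp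
    · have := i.2
      rw [dif_neg h, if_neg h, if_pos (by simp only; omega)]

lemma sgn_mul_sgn (c : Color k ℓ) : c.sgn * c.sgn = 1 := by
  rcases c with i | i
  · simp [sgn]
  · simp only [sgn, Sum.elim_inr]
    split_ifs <;> simp

@[simp] lemma sym_conj (c : Color k ℓ) : c.conj.sym = c.sym := by
  rcases c with i | i <;> rfl

/-- This turns the symplectic dual vector at an outgoing half-edge into a sign times the vector of
that half-edge's own, conjugate, colour. -/
lemma dualVec_eq (i : Fin (2 * ℓ)) :
    dualVec i = (sgn (Sum.inr i : Color k ℓ)) • vec (conj (Sum.inr i : Color k ℓ)) := by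
  simp only [conj, Sum.map_inr, sgn, Sum.elim_inr, vec, dualVec, conjIndex]
  by_cases h : (i : ℕ) < ℓ
  · rw [dif_pos h, dif_pos h, if_pos h]; simp
  · rw [dif_neg h, dif_neg h, if_neg h]; simp

end Color

/-! ### Colourings of half-edges -/

namespace Multigraph

variable (G : Multigraph) {k ℓ : ℕ}

/-- The other half-edge of the same edge. -/
def opp : G.D → G.D := (exists_partner G.edge G.card_ends).choose

lemma opp_involutive : Function.Involutive G.opp :=
  (exists_partner G.edge G.card_ends).choose_spec.1

@[simp] lemma opp_opp (d : G.D) : G.opp (G.opp d) = d := G.opp_involutive d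

lemma opp_ne (d : G.D) : G.opp d ≠ d :=
  (exists_partner G.edge G.card_ends).choose_spec.2.1 d

@[simp] lemma edge_opp (d : G.D) : G.edge (G.opp d) = G.edge d :=
  (exists_partner G.edge G.card_ends).choose_spec.2.2.1 d

lemma eq_or_eq_opp {d d' : G.D} (h : G.edge d' = G.edge d) : d' = d ∨ d' = G.opp d :=
  (exists_partner G.edge G.card_ends).choose_spec.2.2.2 d d' h

/-- A set that contains one of the two half-edges of every edge which is not a circle. -/
def heads : Set G.D :=
  (exists_two_coloring G.opp G.opp G.opp_involutive G.opp_involutive G.opp_ne G.opp_ne).choose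

lemma opp_mem_heads (d : G.D) : G.opp d ∈ G.heads ↔ d ∉ G.heads :=
  ((exists_two_coloring G.opp G.opp G.opp_involutive G.opp_involutive G.opp_ne
    G.opp_ne).choose_spec d).1

variable {G}

open Classical in
/-- The colouring of the half-edges given by a colouring of the edges: the two half-edges of an
edge get conjugate colours. -/
def halfColor (φ : G.E → Color k ℓ) (d : G.D) : Color k ℓ :=
  if d ∈ G.heads then φ (G.edge d) else (φ (G.edge d)).conj

lemma halfColor_opp (φ : G.E → Color k ℓ) (d : G.D) :
    halfColor φ (G.opp d) = (halfColor φ d).conj := by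
  unfold halfColor
  by_cases h : d ∈ G.heads
  · rw [if_pos h, if_neg (by rw [opp_mem_heads]; exact not_not.2 h), edge_opp]
  · rw [if_neg h, if_pos (by rw [opp_mem_heads]; exact h), edge_opp, Color.conj_conj]

@[simp] lemma isRight_halfColor (φ : G.E → Color k ℓ) (d : G.D) :
    (halfColor φ d).isRight = (φ (G.edge d)).isRight := by
  unfold halfColor
  split_ifs <;> simp

end Multigraph

/-! ### The vector of a fragment -/

namespace Fragment

variable {t : ℕ} (F : Fragment t) {k ℓ : ℕ}

/-- The vertices without label. -/
abbrev Interior : Type := {v : F.V // v ∉ Set.range F.label}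

variable {F}

/-- The colours of the half-edges at the labelled vertices. -/
def labelColor (φ : F.E → Color k ℓ) (i : Fin t) : Color k ℓ :=
  Multigraph.halfColor φ (F.openEnd i)

/-- The half-edges of odd colour at a vertex. -/
def oddEndsAt (φ : F.E → Color k ℓ) (v : F.V) : Finset F.D :=
  Finset.univ.filter fun d => F.vert d = v ∧ (Multigraph.halfColor φ d).IsOdd

/-- A list of the half-edges of odd colour at unlabelled vertices. -/
def interiorList (φ : F.E → Color k ℓ) : List F.D :=
  (Finset.univ : Finset F.Interior).toList.flatMap fun v => (oddEndsAt φ v.1).toList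

variable (F) in
/-- The list of the half-edges of odd colour at labelled vertices. -/
def labelList (c : Fin t → Color k ℓ) : List F.D :=
  ((List.finRange t).filter fun i => (c i).IsOdd).map F.openEnd

open Classical in
/-- The half-edges in `heads` that have an odd colour. -/
def oddHeads (φ : F.E → Color k ℓ) : Finset F.D :=
  Finset.univ.filter fun d => d ∈ F.heads ∧ (Multigraph.halfColor φ d).IsOdd

lemma nodup_labelList (c : Fin t → Color k ℓ) : (F.labelList c).Nodup := by
  refine ((List.nodup_finRange t).filter _).map fun i j hij => ?_
  have := congrArg F.vert hij
  rw [vert_openEnd, vert_openEnd] at this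
  exact F.label_injective this

lemma mem_interiorList (φ : F.E → Color k ℓ) (d : F.D) : d ∈ interiorList φ ↔
    F.vert d ∉ Set.range F.label ∧ (φ (F.edge d)).IsOdd := by
  simp [interiorList, oddEndsAt]

lemma nodup_interiorList (φ : F.E → Color k ℓ) : (interiorList φ).Nodup := by
  rw [interiorList, List.nodup_flatMap]
  refine ⟨fun v _ => Finset.nodup_toList _,
    (Finset.nodup_toList _).imp fun {v w} hvw d hd hd' => ?_⟩
  simp only [oddEndsAt, Finset.mem_toList, Finset.mem_filter] at hd hd'
  exact hvw (Subtype.ext (hd.2.1.symm.trans hd'.2.1))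

lemma mem_labelList (φ : F.E → Color k ℓ) (d : F.D) : d ∈ F.labelList (labelColor φ) ↔
    F.vert d ∈ Set.range F.label ∧ (φ (F.edge d)).IsOdd := by
  simp only [labelList, labelColor, List.mem_map, List.mem_filter, List.mem_finRange, true_and,
    decide_eq_true_eq, Multigraph.isRight_halfColor, Color.IsOdd]
  constructor
  · rintro ⟨i, hi, rfl⟩
    exact ⟨⟨i, (F.vert_openEnd i).symm⟩, hi⟩
  · rintro ⟨⟨i, hi⟩, hd⟩
    have := F.eq_openEnd hi.symm
    exact ⟨i, this ▸ hd, this.symm⟩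

lemma nodup_interiorList_append (φ : F.E → Color k ℓ) :
    (interiorList φ ++ F.labelList (labelColor φ)).Nodup := by
  refine (nodup_interiorList φ).append (nodup_labelList _) fun d hd hd' => ?_
  rw [mem_interiorList] at hd
  rw [mem_labelList] at hd'
  exact hd.1 hd'.1

/-- Every odd half-edge is either a head or opposite to a head, and only one of the two, so it
occurs once on each side. The order chosen on the right, interior vertices one after the other and
then labels, is the one that can be compared with the products over vertices and labels. -/
lemma exists_edgeScalar (φ : F.E → Color k ℓ) : ∃ s : ℂ,
    ((∏ d ∈ oddHeads φ, (Multigraph.halfColor φ d).sgn • evenPair (gen d) (gen (F.opp d)) :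
      Subalgebra.center ℂ (Grassmann F.D)) : Grassmann F.D) =
    s • mon (interiorList φ ++ F.labelList (labelColor φ)) := by
  refine exists_coe_prod_smul_evenPair _ _ (fun i _ j _ h => h)
    (fun i _ j _ h => F.opp_involutive.injective h) ?_ (nodup_interiorList_append φ) fun d => ?_
  · intro i hi j hj h
    simp only [oddHeads, Finset.mem_filter] at hi hj
    rw [h, Multigraph.opp_mem_heads] at hi
    exact hi.2.1 hj.2.1
  · rw [List.mem_append, mem_interiorList, mem_labelList]
    simp only [oddHeads, Finset.mem_filter, Finset.mem_univ, true_and, Color.IsOdd,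
      Multigraph.isRight_halfColor]
    constructor
    · intro h
      have ho : (φ (F.edge d)).isRight = true := by tauto
      by_cases hd : d ∈ F.heads
      · exact ⟨d, ⟨hd, ho⟩, Or.inl rfl⟩
      · exact ⟨F.opp d, ⟨(F.opp_mem_heads d).2 hd, by simpa using ho⟩, Or.inr (by simp)⟩
    · rintro ⟨e, ⟨-, he⟩, rfl | rfl⟩
      · tauto
      · rw [Multigraph.edge_opp]; tauto

/-- The scalar by which the product over the edges differs from the product of all generators. -/
def edgeScalar (φ : F.E → Color k ℓ) : ℂ := (exists_edgeScalar φ).choose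

lemma edgeScalar_spec (φ : F.E → Color k ℓ) :
    ((∏ d ∈ oddHeads φ, (Multigraph.halfColor φ d).sgn • evenPair (gen d) (gen (F.opp d)) :
      Subalgebra.center ℂ (Grassmann F.D)) : Grassmann F.D) =
    edgeScalar φ • mon (interiorList φ ++ F.labelList (labelColor φ)) :=
  (exists_edgeScalar φ).choose_spec

variable (h : EdgeColoringModel k ℓ)

/-- The value of the model at a vertex. -/
def vertexValue (φ : F.E → Color k ℓ) (v : F.V) : ℂ :=
  h ((∏ d ∈ Finset.univ.filter fun d => F.vert d = v, (Multigraph.halfColor φ d).sym) ⊗ₜ[ℂ]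
    ((oddEndsAt φ v).toList.map fun d =>
      ExteriorAlgebra.ι ℂ (Multigraph.halfColor φ d).vec).prod)

/-- At every unlabelled vertex, the number of half-edges of odd colour is even. -/
def IsEvenColoring (φ : F.E → Color k ℓ) : Prop := ∀ v : F.Interior, Even (oddEndsAt φ v.1).card

/-- The weight of a colouring of a fragment. -/
def weight (φ : F.E → Color k ℓ) : ℂ :=
  (-1) ^ Nat.card {e // (φ e).IsOdd} * edgeScalar φ * ∏ v : F.Interior, vertexValue h φ v.1

open Classical in
/-- The vector in `(V_k ⊕ V_{2ℓ})^{⊗ t}` of a fragment, in coordinates. -/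
def coordinates (F : Fragment t) (c : Fin t → Color k ℓ) : ℂ :=
  ∑ φ : F.E → Color k ℓ, if IsEvenColoring φ ∧ labelColor φ = c then weight h φ else 0

/-- The entries of the matrix of the bilinear form on `(V_k ⊕ V_{2ℓ})^{⊗ t}` given by gluing. -/
def glueSign (c : Fin t → Color k ℓ) : ℂ :=
  (((List.finRange t).filter fun i => (c i).IsOdd).map fun i => (c i).sgn).prod *
    (-1) ^ ((List.finRange t).filter fun i => (c i).IsOdd).length.choose 2

lemma glueSign_mul_self (c : Fin t → Color k ℓ) : glueSign c * glueSign c = 1 := by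
  have h1 : ∀ l : List (Fin t), (l.map fun i => (c i).sgn).prod *
      (l.map fun i => (c i).sgn).prod = 1 := by
    intro l
    induction l with
    | nil => simp
    | cons i l ih =>
      rw [List.map_cons, List.prod_cons, mul_mul_mul_comm, ih, Color.sgn_mul_sgn, one_mul]
  rw [glueSign, mul_mul_mul_comm, h1, ← mul_pow]
  simp

end Fragment

/-! ### Half-edges of two fragments that are glued -/

namespace Fragment

variable {t : ℕ} {F₁ F₂ : Fragment t}

/-- The edge of a half-edge of `F₁ ∪ F₂`. -/
def sumEdge : F₁.D ⊕ F₂.D → F₁.E ⊕ F₂.E := Sum.map F₁.edge F₂.edge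

/-- The other half-edge of the same edge of `F₁ ∪ F₂`. -/
def sumOpp : F₁.D ⊕ F₂.D → F₁.D ⊕ F₂.D := Sum.map F₁.opp F₂.opp

/-- The edge of `F₁ * F₂` that contains a half-edge of `F₁ ∪ F₂`. -/
def gluedEdge (x : F₁.D ⊕ F₂.D) : (F₁.glue F₂).E := Quot.mk _ (sumEdge x)

/-- The half-edges of `F₁ * F₂` are half-edges of `F₁ ∪ F₂`. -/
def inclEnd : (F₁.glue F₂).D → F₁.D ⊕ F₂.D := Sum.map Subtype.val Subtype.val

lemma sumOpp_involutive : Function.Involutive (sumOpp : F₁.D ⊕ F₂.D → _) := by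
  rintro (d | d) <;> simp [sumOpp]

lemma sumOpp_ne (x : F₁.D ⊕ F₂.D) : sumOpp x ≠ x := by
  rcases x with d | d <;> simp [sumOpp, Multigraph.opp_ne]

@[simp] lemma sumEdge_sumOpp (x : F₁.D ⊕ F₂.D) : sumEdge (sumOpp x) = sumEdge x := by
  rcases x with d | d <;> simp [sumOpp, sumEdge]

@[simp] lemma gluedEdge_sumOpp (x : F₁.D ⊕ F₂.D) : gluedEdge (sumOpp x) = gluedEdge x := by
  rw [gluedEdge, sumEdge_sumOpp]; rfl

lemma eq_or_eq_sumOpp {x y : F₁.D ⊕ F₂.D} (h : sumEdge y = sumEdge x) : y = x ∨ y = sumOpp x := by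
  rcases x with d | d <;> rcases y with e | e <;>
    simp only [sumEdge, Sum.map_inl, Sum.map_inr, reduceCtorEq, Sum.inl.injEq, Sum.inr.injEq] at h
  · exact (F₁.eq_or_eq_opp h).imp (congrArg _) (congrArg _)
  · exact (F₂.eq_or_eq_opp h).imp (congrArg _) (congrArg _)

lemma inclEnd_injective : Function.Injective (inclEnd : (F₁.glue F₂).D → _) :=
  Subtype.val_injective.sumMap Subtype.val_injective

lemma edge_glue (d : (F₁.glue F₂).D) : (F₁.glue F₂).edge d = gluedEdge (inclEnd d) := by
  rcases d with d | d <;> rfl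

variable (F₁ F₂) in
lemma gluedEdge_openEnd (i : Fin t) : gluedEdge (F₁ := F₁) (F₂ := F₂) (Sum.inl (F₁.openEnd i)) =
    gluedEdge (Sum.inr (F₂.openEnd i)) := Quot.sound ⟨i, rfl, rfl⟩

lemma end_cases (x : F₁.D ⊕ F₂.D) : (∃ d, inclEnd d = x) ∨ (∃ i, x = Sum.inl (F₁.openEnd i)) ∨
    ∃ i, x = Sum.inr (F₂.openEnd i) := by
  rcases x with d | d
  · by_cases h : F₁.vert d ∈ Set.range F₁.label
    · obtain ⟨i, hi⟩ := h
      exact Or.inr (Or.inl ⟨i, congrArg Sum.inl (F₁.eq_openEnd hi.symm)⟩)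
    · exact Or.inl ⟨Sum.inl ⟨d, h⟩, rfl⟩
  · by_cases h : F₂.vert d ∈ Set.range F₂.label
    · obtain ⟨i, hi⟩ := h
      exact Or.inr (Or.inr ⟨i, congrArg Sum.inr (F₂.eq_openEnd hi.symm)⟩)
    · exact Or.inl ⟨Sum.inr ⟨d, h⟩, rfl⟩

lemma openEnd_injective (F : Fragment t) : Function.Injective F.openEnd := fun i j hij =>
  F.label_injective (by rw [← vert_openEnd, ← vert_openEnd, hij])

lemma inclEnd_ne_inl_openEnd (d : (F₁.glue F₂).D) (i : Fin t) :
    inclEnd d ≠ Sum.inl (F₁.openEnd i) := by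
  rcases d with d | d
  · intro h
    have := Sum.inl_injective h
    exact d.2 ⟨i, by rw [this, vert_openEnd]⟩
  · exact Sum.inr_ne_inl

lemma inclEnd_ne_inr_openEnd (d : (F₁.glue F₂).D) (i : Fin t) :
    inclEnd d ≠ Sum.inr (F₂.openEnd i) := by
  rcases d with d | d
  · exact Sum.inl_ne_inr
  · intro h
    have := Sum.inr_injective h
    exact d.2 ⟨i, by rw [this, vert_openEnd]⟩

/-- The half-edges in `heads`. -/
def IsHead : F₁.D ⊕ F₂.D → Prop := Sum.elim (· ∈ F₁.heads) (· ∈ F₂.heads)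

lemma isHead_sumOpp (x : F₁.D ⊕ F₂.D) : IsHead (sumOpp x) ↔ ¬IsHead x := by
  rcases x with d | d
  · exact F₁.opp_mem_heads d
  · exact F₂.opp_mem_heads d

/-- An orientation of the edges of `F₁ ∪ F₂` that fits together at the labelled vertices and
extends a given orientation of edges of `F₁ * F₂`. -/
structure OrientationExtension {F : Set (F₁.glue F₂).E} (ω : Multigraph.Orientation F) where
  incoming : Set (F₁.D ⊕ F₂.D)
  sumOpp_mem : ∀ x, sumOpp x ∈ incoming ↔ x ∉ incoming
  openEnd_mem : ∀ i, Sum.inr (F₂.openEnd i) ∈ incoming ↔ Sum.inl (F₁.openEnd i) ∉ incoming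
  inclEnd_mem : ∀ a : Multigraph.HalfEdge F, inclEnd a.1 ∈ incoming ↔ a ∈ ω.incoming

/-- A reference orientation of all edges of F₁ * F₂ that is also defined on the pieces of edges
inside F₁ and F₂. It exists because two fixed-point-free involutions have a common two-colouring. -/
lemma exists_two_coloring_glue : ∃ c : Set (F₁.D ⊕ F₂.D), (∀ x, sumOpp x ∈ c ↔ x ∉ c) ∧
    (∀ i, Sum.inr (F₂.openEnd i) ∈ c ↔ Sum.inl (F₁.openEnd i) ∉ c) ∧
    ∀ d : (F₁.glue F₂).D, inclEnd ((F₁.glue F₂).opp d) ∈ c ↔ inclEnd d ∉ c := by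
  classical
  -- On half-edges that survive the gluing `τ` jumps to the other end of the whole glued edge; on
  -- open ends it crosses the gluing point. Unlike `glueSwap` it has no fixed points.
  let τ : F₁.D ⊕ F₂.D → F₁.D ⊕ F₂.D := fun x =>
    if h : ∃ d, inclEnd d = x then inclEnd ((F₁.glue F₂).opp h.choose) else glueSwap F₁ F₂ x
  have h1 : ∀ d : (F₁.glue F₂).D, τ (inclEnd d) = inclEnd ((F₁.glue F₂).opp d) := by
    intro d
    have h : ∃ d', inclEnd d' = inclEnd d := ⟨d, rfl⟩
    have h' := inclEnd_injective h.choose_spec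
    simp only [τ]
    rw [dif_pos h, h']
  have h2 : ∀ i, τ (Sum.inl (F₁.openEnd i)) = Sum.inr (F₂.openEnd i) := by
    intro i
    simp only [τ]
    rw [dif_neg (fun ⟨d, hd⟩ => inclEnd_ne_inl_openEnd d i hd), glueSwap_inl_openEnd]
  have h3 : ∀ i, τ (Sum.inr (F₂.openEnd i)) = Sum.inl (F₁.openEnd i) := by
    intro i
    simp only [τ]
    rw [dif_neg (fun ⟨d, hd⟩ => inclEnd_ne_inr_openEnd d i hd), glueSwap_inr_openEnd]
  have hτ : Function.Involutive τ := by
    intro x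
    rcases end_cases x with ⟨d, rfl⟩ | ⟨i, rfl⟩ | ⟨i, rfl⟩
    · rw [h1, h1, Multigraph.opp_opp]
    · rw [h2, h3]
    · rw [h3, h2]
  have hτ' : ∀ x, τ x ≠ x := by
    intro x
    rcases end_cases x with ⟨d, rfl⟩ | ⟨i, rfl⟩ | ⟨i, rfl⟩
    · rw [h1]
      exact fun h => Multigraph.opp_ne _ d (inclEnd_injective h)
    · rw [h2]; exact Sum.inr_ne_inl
    · rw [h3]; exact Sum.inl_ne_inr
  obtain ⟨c, hc⟩ := exists_two_coloring sumOpp τ sumOpp_involutive hτ sumOpp_ne hτ'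
  refine ⟨c, fun x => (hc x).1, fun i => ?_, fun d => ?_⟩
  · rw [← h2]; exact (hc _).2
  · rw [← h1]; exact (hc _).2

/-- The reference orientation is reversed along those glued edges where it disagrees with `ω`. Whole
glued edges are reversed, so the conditions inside the fragments and at the labels survive. -/
lemma nonempty_orientationExtension {F : Set (F₁.glue F₂).E} (ω : Multigraph.Orientation F) :
    Nonempty (OrientationExtension ω) := by
  obtain ⟨c, hc1, hc2, hc3⟩ := exists_two_coloring_glue (F₁ := F₁) (F₂ := F₂)
  -- `A` singles out the glued edges to be reversed. Disagreement at one end implies disagreement at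
  -- the other, as both orientations are opposite at the two ends.
  obtain ⟨A, hA⟩ : ∃ A : (F₁.glue F₂).E → Prop, ∀ e, A e ↔ ∃ a : Multigraph.HalfEdge F,
      (F₁.glue F₂).edge a.1 = e ∧ ¬(inclEnd a.1 ∈ c ↔ a ∈ ω.incoming) := ⟨_, fun _ => Iff.rfl⟩
  refine ⟨⟨{x | ¬(x ∈ c ↔ A (gluedEdge x))}, fun x => ?_, fun i => ?_, fun a => ?_⟩⟩
  · simp only [Set.mem_ofPred_eq, gluedEdge_sumOpp, hc1]
    grind
  · simp only [Set.mem_ofPred_eq, ← gluedEdge_openEnd, hc2]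
    grind
  · simp only [Set.mem_ofPred_eq, ← edge_glue]
    by_cases ha : A ((F₁.glue F₂).edge a.1)
    · obtain ⟨b, hb, hb'⟩ := (hA _).1 ha
      simp only [ha, iff_true]
      rcases (F₁.glue F₂).eq_or_eq_opp hb with h | h
      · have := Subtype.ext h
        subst this
        grind
      · have hab : a ≠ b := by
          rintro rfl
          exact Multigraph.opp_ne _ _ h.symm
        have h1 := ω.opposite a b hab (Subtype.ext hb.symm)
        have h2 := hc3 a.1
        rw [← h] at h2
        grind
    · have : (inclEnd a.1 ∈ c ↔ a ∈ ω.incoming) := by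
        by_contra h
        exact ha ((hA _).2 ⟨a, rfl, h⟩)
      simp only [ha, iff_false, not_not]
      exact this

/-! ### The permutation of pairs of half-edges given by a local pairing -/

section Pairing

variable {F : Set (F₁.glue F₂).E} (κ : Multigraph.LocalPairing F) {ω : Multigraph.Orientation F}
  (Ω : OrientationExtension ω)

/-- The pairs of a local pairing of `F₁ * F₂`, together with the pairs of half-edges of `F₁ ∪ F₂`
at labelled vertices that have to be glued. -/
abbrev PairIndex : Type :=
  (Σ v : (F₁.glue F₂).V, {p // p ∈ κ.pairs v}) ⊕
    {i : Fin t // gluedEdge (F₁ := F₁) (F₂ := F₂) (Sum.inl (F₁.openEnd i)) ∈ F}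

variable {κ}

open Classical in
/-- The incoming half-edge of a pair. -/
def inEnd : PairIndex κ → F₁.D ⊕ F₂.D
  | Sum.inl p => inclEnd p.2.1.1.1
  | Sum.inr i => if Sum.inl (F₁.openEnd i.1) ∈ Ω.incoming then Sum.inl (F₁.openEnd i.1)
      else Sum.inr (F₂.openEnd i.1)

open Classical in
/-- The outgoing half-edge of a pair. -/
def outEnd : PairIndex κ → F₁.D ⊕ F₂.D
  | Sum.inl p => inclEnd p.2.1.2.1
  | Sum.inr i => if Sum.inl (F₁.openEnd i.1) ∈ Ω.incoming then Sum.inr (F₂.openEnd i.1)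
      else Sum.inl (F₁.openEnd i.1)

lemma inEnd_mem (hκ : κ.Compatible ω) (j : PairIndex κ) : inEnd Ω j ∈ Ω.incoming := by
  rcases j with ⟨v, p⟩ | i
  · exact (Ω.inclEnd_mem _).2 (hκ v p.1 p.2).1
  · simp only [inEnd]
    split_ifs with h
    · exact h
    · exact (Ω.openEnd_mem _).2 h

lemma outEnd_notMem (hκ : κ.Compatible ω) (j : PairIndex κ) : outEnd Ω j ∉ Ω.incoming := by
  rcases j with ⟨v, p⟩ | i
  · exact fun h => (hκ v p.1 p.2).2 ((Ω.inclEnd_mem _).1 h)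
  · simp only [outEnd]
    split_ifs with h
    · exact fun h' => (Ω.openEnd_mem _).1 h' h
    · exact h

lemma gluedEdge_inEnd_mem (j : PairIndex κ) : gluedEdge (inEnd Ω j) ∈ F := by
  rcases j with ⟨v, p⟩ | i
  · simp only [inEnd, ← edge_glue]
    exact p.1.1.2
  · simp only [inEnd]
    split_ifs with h
    · exact i.2
    · rw [← gluedEdge_openEnd]; exact i.2

lemma gluedEdge_outEnd_mem (j : PairIndex κ) : gluedEdge (outEnd Ω j) ∈ F := by
  rcases j with ⟨v, p⟩ | i
  · simp only [outEnd, ← edge_glue]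
    exact p.1.2.2
  · simp only [outEnd]
    split_ifs with h
    · rw [← gluedEdge_openEnd]; exact i.2
    · exact i.2

lemma pair_ext {v w : (F₁.glue F₂).V} {p : {p // p ∈ κ.pairs v}} {p' : {p // p ∈ κ.pairs w}}
    {a : Multigraph.HalfEdge F} (hp : p.1.1 = a ∨ p.1.2 = a) (hp' : p'.1.1 = a ∨ p'.1.2 = a) :
    (⟨v, p⟩ : Σ v : (F₁.glue F₂).V, {p // p ∈ κ.pairs v}) = ⟨w, p'⟩ := by
  obtain ⟨p, hpv⟩ := p
  obtain ⟨p', hpw⟩ := p'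
  have hv : a.toVert = v := by
    rcases hp with rfl | rfl
    · exact (κ.mem_vert v p hpv).1
    · exact (κ.mem_vert v p hpv).2
  have hw : a.toVert = w := by
    rcases hp' with rfl | rfl
    · exact (κ.mem_vert w p' hpw).1
    · exact (κ.mem_vert w p' hpw).2
  subst hv
  subst hw
  have := (κ.existsUnique a).unique ⟨hpv, hp⟩ ⟨hpw, hp'⟩
  subst this
  rfl

lemma inEnd_injective : Function.Injective (inEnd (κ := κ) Ω) := by
  rintro (⟨v, p⟩ | i) (⟨w, p'⟩ | j) h <;> simp only [inEnd] at h
  · have := Subtype.ext (inclEnd_injective h)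
    exact congrArg Sum.inl (pair_ext (Or.inl rfl) (Or.inl this.symm))
  · split_ifs at h
    · exact absurd h (inclEnd_ne_inl_openEnd _ _)
    · exact absurd h (inclEnd_ne_inr_openEnd _ _)
  · split_ifs at h
    · exact absurd h.symm (inclEnd_ne_inl_openEnd _ _)
    · exact absurd h.symm (inclEnd_ne_inr_openEnd _ _)
  · split_ifs at h
    · exact congrArg Sum.inr (Subtype.ext (F₁.openEnd_injective (Sum.inl_injective h)))
    · exact congrArg Sum.inr (Subtype.ext (F₂.openEnd_injective (Sum.inr_injective h)))

lemma outEnd_injective : Function.Injective (outEnd (κ := κ) Ω) := by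
  rintro (⟨v, p⟩ | i) (⟨w, p'⟩ | j) h <;> simp only [outEnd] at h
  · have := Subtype.ext (inclEnd_injective h)
    exact congrArg Sum.inl (pair_ext (Or.inr rfl) (Or.inr this.symm))
  · split_ifs at h
    · exact absurd h (inclEnd_ne_inr_openEnd _ _)
    · exact absurd h (inclEnd_ne_inl_openEnd _ _)
  · split_ifs at h
    · exact absurd h.symm (inclEnd_ne_inr_openEnd _ _)
    · exact absurd h.symm (inclEnd_ne_inl_openEnd _ _)
  · split_ifs at h
    · exact congrArg Sum.inr (Subtype.ext (F₂.openEnd_injective (Sum.inr_injective h)))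
    · exact congrArg Sum.inr (Subtype.ext (F₁.openEnd_injective (Sum.inl_injective h)))

lemma exists_inEnd (hκ : κ.Compatible ω) {x : F₁.D ⊕ F₂.D} (hx : gluedEdge x ∈ F)
    (hx' : x ∈ Ω.incoming) : ∃ j : PairIndex κ, inEnd Ω j = x := by
  rcases end_cases x with ⟨d, rfl⟩ | ⟨i, rfl⟩ | ⟨i, rfl⟩
  · rw [← edge_glue] at hx
    obtain ⟨p, ⟨hp, hpa⟩, -⟩ := κ.existsUnique ⟨d, hx⟩
    rcases hpa with h | h
    · exact ⟨Sum.inl ⟨_, ⟨p, hp⟩⟩, by simp only [inEnd, h]⟩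
    · exact absurd ((Ω.inclEnd_mem _).1 hx') (h ▸ (hκ _ p hp).2)
  · exact ⟨Sum.inr ⟨i, hx⟩, if_pos hx'⟩
  · exact ⟨Sum.inr ⟨i, by rwa [gluedEdge_openEnd]⟩, if_neg ((Ω.openEnd_mem i).1 hx')⟩

instance : Finite (PairIndex κ) := inferInstance

/-- The step along a circuit: leave through the outgoing end of a pair and follow the edge of F₁ ∪
F₂ to its other half-edge, which is the incoming end of a unique pair. -/
lemma exists_perm (hκ : κ.Compatible ω) : ∃ π : Equiv.Perm (PairIndex κ),
    ∀ j, inEnd Ω (π j) = sumOpp (outEnd Ω j) := by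
  have h : ∀ j : PairIndex κ, ∃ j', inEnd Ω j' = sumOpp (outEnd Ω j) := fun j =>
    exists_inEnd Ω hκ (by rw [gluedEdge_sumOpp]; exact gluedEdge_outEnd_mem Ω j)
      ((Ω.sumOpp_mem _).2 (outEnd_notMem Ω hκ j))
  choose f hf using h
  have hinj : Function.Injective f := fun i j hij => by
    have := (hf i).symm.trans ((congrArg _ hij).trans (hf j))
    exact outEnd_injective Ω (sumOpp_involutive.injective this)
  exact ⟨Equiv.ofBijective f (Finite.injective_iff_bijective.1 hinj), hf⟩

open Classical in
-- Orbits are counted on edges of F₁ ∪ F₂ rather than on edges of F₁ * F₂, since that count is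
-- additive over the fragments.
lemma neg_one_pow_numCircuits (hκ : κ.Compatible ω) [Fintype (PairIndex κ)]
    {π : Equiv.Perm (PairIndex κ)} (hπ : ∀ j, inEnd Ω (π j) = sumOpp (outEnd Ω j)) :
    (-1 : ℂ) ^ κ.numCircuits = ((Equiv.Perm.sign π : ℤ) : ℂ) *
      (-1) ^ Nat.card {e : F₁.E ⊕ F₂.E // Quot.mk (GlueRel F₁ F₂) e ∈ F} := by
  let T := {e : F₁.E ⊕ F₂.E // Quot.mk (GlueRel F₁ F₂) e ∈ F}
  let f : PairIndex κ → T := fun j => ⟨sumEdge (inEnd Ω j), gluedEdge_inEnd_mem Ω j⟩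
  have hf : Function.Injective f := by
    intro i j hij
    rcases eq_or_eq_sumOpp (congrArg Subtype.val hij) with h | h
    · exact inEnd_injective Ω h
    · exact absurd (inEnd_mem Ω hκ i) (by
        rw [h, Ω.sumOpp_mem]; exact not_not.2 (inEnd_mem Ω hκ j))
  -- Each edge that has half-edges carries exactly one incoming half-edge, so `f` identifies pairs
  -- with such edges. The remaining edges, the circles of F₁ and F₂, become fixed points and are
  -- circuits of their own.
  let π' : Equiv.Perm T := π.extendDomain (Equiv.ofInjective f hf)
  have hπ1 : ∀ j, π' (f j) = f (π j) := fun j =>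
    Equiv.Perm.extendDomain_apply_image π (Equiv.ofInjective f hf) j
  have hπ2 : ∀ e, e ∉ Set.range f → π' e = e := fun e he =>
    Equiv.Perm.extendDomain_apply_not_subtype π (Equiv.ofInjective f hf) he
  have hfπ : ∀ j, (f (π j)).1 = sumEdge (outEnd Ω j) := fun j => by
    change sumEdge _ = _
    rw [hπ, sumEdge_sumOpp]
  let g : T → Quot κ.Consecutive := fun e => Quot.mk _ ⟨Quot.mk _ e.1, e.2⟩
  have hg : Function.Surjective g := by
    rintro ⟨⟨⟨e⟩, he⟩⟩
    exact ⟨⟨e, he⟩, rfl⟩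
  have hgπ : ∀ e, g (π' e) = g e := by
    intro e
    by_cases he : e ∈ Set.range f
    · obtain ⟨j, rfl⟩ := he
      rw [hπ1]
      have h1 : g (f (π j)) = Quot.mk _ ⟨gluedEdge (outEnd Ω j), gluedEdge_outEnd_mem Ω j⟩ := by
        simp only [g, hfπ]
        rfl
      rw [h1]
      rcases j with ⟨v, p⟩ | i
      · refine (Quot.sound ⟨v, p.1, p.2, ?_, ?_⟩).symm
        · exact Subtype.ext (edge_glue _)
        · exact Subtype.ext (edge_glue _)
      · simp only [g, f]
        congr 2
        change gluedEdge _ = gluedEdge _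
        simp only [inEnd, outEnd]
        split_ifs
        · exact (gluedEdge_openEnd F₁ F₂ i).symm
        · exact gluedEdge_openEnd F₁ F₂ i
    · rw [hπ2 e he]
  let S := Equiv.Perm.SameCycle.setoid π'
  have hmk : ∀ a b : T, (Quotient.mk S a = Quotient.mk S b) ↔ π'.SameCycle a b :=
    fun a b => Quotient.eq (r := S)
  have hstep : ∀ j, Quotient.mk S (f j) = Quotient.mk S (f (π j)) := fun j =>
    (hmk _ _).2 ⟨1, by rw [zpow_one, hπ1]⟩
  -- The orbit is well defined on glued edges, because edges glued at a label are successive under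
  -- `π'`. The value `none` is used outside `F`. The map `M` below passes on to circuits and shows
  -- that distinct orbits lie in distinct circuits.
  let m : (F₁.glue F₂).E → Option (Quotient S) :=
    Quot.lift (fun e => if h : Quot.mk (GlueRel F₁ F₂) e ∈ F then some (Quotient.mk S ⟨e, h⟩)
      else none) (by
      intro a b hab
      have hab' : Quot.mk (GlueRel F₁ F₂) a = Quot.mk (GlueRel F₁ F₂) b := Quot.sound hab
      by_cases ha : Quot.mk (GlueRel F₁ F₂) a ∈ F
      · have hb : Quot.mk (GlueRel F₁ F₂) b ∈ F := hab' ▸ ha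
        simp only [dif_pos ha, dif_pos hb]
        obtain ⟨i, rfl, rfl⟩ := hab
        have hs := hstep (Sum.inr ⟨i, ha⟩)
        have e2 := hfπ (Sum.inr ⟨i, ha⟩)
        by_cases hi : Sum.inl (F₁.openEnd i) ∈ Ω.incoming
        · have h1 : f (Sum.inr ⟨i, ha⟩) = ⟨Sum.inl (F₁.edge (F₁.openEnd i)), ha⟩ :=
            Subtype.ext (by simp only [f, inEnd, if_pos hi]; rfl)
          have h2 : f (π (Sum.inr ⟨i, ha⟩)) = ⟨Sum.inr (F₂.edge (F₂.openEnd i)), hb⟩ :=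
            Subtype.ext (by rw [e2]; simp only [outEnd, if_pos hi]; rfl)
          rw [← h1, ← h2, hs]
        · have h1 : f (Sum.inr ⟨i, ha⟩) = ⟨Sum.inr (F₂.edge (F₂.openEnd i)), hb⟩ :=
            Subtype.ext (by simp only [f, inEnd, if_neg hi]; rfl)
          have h2 : f (π (Sum.inr ⟨i, ha⟩)) = ⟨Sum.inl (F₁.edge (F₁.openEnd i)), ha⟩ :=
            Subtype.ext (by rw [e2]; simp only [outEnd, if_neg hi]; rfl)
          rw [← h1, ← h2, hs]
      · have hb : Quot.mk (GlueRel F₁ F₂) b ∉ F := hab' ▸ ha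
        simp only [dif_neg ha, dif_neg hb])
  have hm : ∀ e : T, m (Quot.mk _ e.1) = some (Quotient.mk S e) := fun e => dif_pos e.2
  let M : Quot κ.Consecutive → Option (Quotient S) :=
    Quot.lift (fun e => m e.1) (by
      rintro a b ⟨v, p, hp, rfl, rfl⟩
      let j : PairIndex κ := Sum.inl ⟨v, ⟨p, hp⟩⟩
      have h1 : (p.1.toEdge).1 = Quot.mk _ (f j).1 := edge_glue _
      have h2 : (p.2.toEdge).1 = Quot.mk _ (f (π j)).1 := by
        rw [hfπ]; exact edge_glue _
      change m p.1.toEdge.1 = m p.2.toEdge.1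
      rw [h1, h2, hm, hm, hstep])
  have key : ∀ a b, g a = g b ↔ π'.SameCycle a b := by
    intro a b
    constructor
    · intro hab
      have := congrArg M hab
      change m (Quot.mk _ a.1) = m (Quot.mk _ b.1) at this
      rw [hm, hm] at this
      exact (hmk _ _).1 (Option.some_injective _ this)
    · rintro ⟨n, rfl⟩
      have hpow : ∀ (n : ℕ) (x : T), g ((π' ^ n) x) = g x := by
        intro n x
        induction n with
        | zero => rfl
        | succ n ih => rw [pow_succ', Equiv.Perm.mul_apply, hgπ, ih]
      obtain ⟨n, rfl | rfl⟩ := n.eq_nat_or_neg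
      · rw [zpow_natCast, hpow]
      · rw [zpow_neg, zpow_natCast]
        conv_lhs => rw [← (π' ^ n).apply_symm_apply a]
        exact hpow n _
  have hfin := neg_one_pow_card_orbits π' g hg key
  rw [Multigraph.LocalPairing.numCircuits, hfin, Nat.card_eq_fintype_card]
  congr 3
  exact Equiv.Perm.sign_extendDomain π (Equiv.ofInjective f hf)

end Pairing

end Fragment

/-! ### Colourings of the glued graph restricted to the fragments -/

/-- Both sets choose one element from each of the same pairs {x, σ x}, and `w` is constant on these
pairs. -/
lemma prod_transversal {X R : Type*} [DecidableEq X] [CommMonoid R] {σ : X → X}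
    (hσ : Function.Involutive σ) {A B : Finset X} {w : X → R} (hw : ∀ x ∈ A, w (σ x) = w x)
    (hA : ∀ x ∈ A, σ x ∉ A) (hB : ∀ x ∈ B, σ x ∉ B) (hAB : ∀ x ∈ A, x ∈ B ∨ σ x ∈ B)
    (hBA : ∀ x ∈ B, x ∈ A ∨ σ x ∈ A) : ∏ x ∈ A, w x = ∏ x ∈ B, w x := by
  refine Finset.prod_bij' (fun x _ => if x ∈ B then x else σ x)
    (fun x _ => if x ∈ A then x else σ x) ?_ ?_ ?_ ?_ ?_
  · intro x hx
    have := hAB x hx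
    split_ifs with h <;> tauto
  · intro x hx
    have := hBA x hx
    split_ifs with h <;> tauto
  · intro x hx
    by_cases h : x ∈ B
    · simp [h, hx]
    · simp [h, hA x hx, hσ x]
  · intro x hx
    by_cases h : x ∈ A
    · simp [h, hx]
    · simp [h, hB x hx, hσ x]
  · intro x hx
    split_ifs with h
    · rfl
    · exact (hw x hx).symm

lemma coe_prod_of_coe_eq_smul_mon {X V : Type} (A : Finset V)
    (C : V → Subalgebra.center ℂ (Grassmann X)) (δ : V → ℂ) (l : V → List X)
    (h : ∀ v, (C v : Grassmann X) = δ v • mon (l v)) :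
    ((∏ v ∈ A, C v : Subalgebra.center ℂ (Grassmann X)) : Grassmann X) =
      (∏ v ∈ A, δ v) • mon (A.toList.flatMap l) := by
  rw [← Finset.prod_map_toList, ← Finset.prod_map_toList]
  induction A.toList with
  | nil => simp
  | cons v L ih =>
    rw [List.map_cons, List.prod_cons, List.map_cons, List.prod_cons, List.flatMap_cons,
      mon_append]
    change _ * _ = _
    rw [ih, h, smul_mul_smul_comm]

namespace Fragment

variable {t k ℓ : ℕ} {F₁ F₂ : Fragment t}

lemma prod_glue_V {R : Type*} [CommMonoid R] (f : (F₁.glue F₂).V → R) :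
    ∏ v, f v = (∏ v : F₁.Interior, f (Sum.inl v)) * ∏ v : F₂.Interior, f (Sum.inr v) := by
  refine Eq.trans ?_ (Fintype.prod_sum_type (α₁ := F₁.Interior) (α₂ := F₂.Interior) f)
  refine Finset.prod_congr ?_ fun _ _ => rfl
  ext v
  exact ⟨fun _ => Finset.mem_univ (α := F₁.Interior ⊕ F₂.Interior) v, fun _ => Finset.mem_univ _⟩

/-- The half-edges at an unlabelled vertex of `F₁`. -/
lemma bijective_endsAt_inl (A : Set (F₁.glue F₂).E) (v : F₁.Interior) :
    Function.Bijective (fun d : {d : F₁.D // F₁.vert d = v.1 ∧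
      gluedEdge (F₁ := F₁) (F₂ := F₂) (Sum.inl d) ∈ A} =>
      (⟨⟨Sum.inl ⟨d.1, by rw [d.2.1]; exact v.2⟩, d.2.2⟩,
        congrArg Sum.inl (Subtype.ext d.2.1)⟩ :
        {a : Multigraph.HalfEdge A // a.toVert = Sum.inl v})) := by
  constructor
  · intro d d' h
    have := congrArg (fun a => inclEnd a.1.1) h
    exact Subtype.ext (Sum.inl_injective (show Sum.inl d.1 = Sum.inl d'.1 from this))
  · rintro ⟨⟨d | d, h⟩, hv⟩
    · exact ⟨⟨d.1, congrArg Subtype.val (Sum.inl_injective hv), h⟩, rfl⟩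
    · exact absurd hv Sum.inr_ne_inl

/-- The half-edges at an unlabelled vertex of `F₂`. -/
lemma bijective_endsAt_inr (A : Set (F₁.glue F₂).E) (v : F₂.Interior) :
    Function.Bijective (fun d : {d : F₂.D // F₂.vert d = v.1 ∧
      gluedEdge (F₁ := F₁) (F₂ := F₂) (Sum.inr d) ∈ A} =>
      (⟨⟨Sum.inr ⟨d.1, by rw [d.2.1]; exact v.2⟩, d.2.2⟩,
        congrArg Sum.inr (Subtype.ext d.2.1)⟩ :
        {a : Multigraph.HalfEdge A // a.toVert = Sum.inr v})) := by
  constructor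
  · intro d d' h
    have := congrArg (fun a => inclEnd a.1.1) h
    exact Subtype.ext (Sum.inr_injective (show Sum.inr d.1 = Sum.inr d'.1 from this))
  · rintro ⟨⟨d | d, h⟩, hv⟩
    · exact absurd hv Sum.inl_ne_inr
    · exact ⟨⟨d.1, congrArg Subtype.val (Sum.inr_injective hv), h⟩, rfl⟩

/-- The colouring of the half-edges of `F₁ ∪ F₂`. -/
def sumColor (φ₁ : F₁.E → Color k ℓ) (φ₂ : F₂.E → Color k ℓ) : F₁.D ⊕ F₂.D → Color k ℓ :=
  Sum.elim (Multigraph.halfColor φ₁) (Multigraph.halfColor φ₂)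

lemma sumColor_sumOpp (φ₁ : F₁.E → Color k ℓ) (φ₂ : F₂.E → Color k ℓ) (x : F₁.D ⊕ F₂.D) :
    sumColor φ₁ φ₂ (sumOpp x) = (sumColor φ₁ φ₂ x).conj := by
  rcases x with d | d <;> simp [sumColor, sumOpp, Multigraph.halfColor_opp]

section Parity

variable {F : Set (F₁.glue F₂).E} {φ₁ : F₁.E → Color k ℓ} {φ₂ : F₂.E → Color k ℓ}

lemma card_oddEndsAt_inl (hF : ∀ x, gluedEdge x ∈ F ↔ (sumColor φ₁ φ₂ x).IsOdd)
    (v : F₁.Interior) :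
    Nat.card {a : Multigraph.HalfEdge F // a.toVert = Sum.inl v} = (oddEndsAt φ₁ v.1).card := by
  rw [← Nat.card_eq_of_bijective _ (bijective_endsAt_inl F v), oddEndsAt,
    Nat.subtype_card]
  intro d
  rw [Finset.mem_filter, hF]
  simp [sumColor]

lemma card_oddEndsAt_inr (hF : ∀ x, gluedEdge x ∈ F ↔ (sumColor φ₁ φ₂ x).IsOdd)
    (v : F₂.Interior) :
    Nat.card {a : Multigraph.HalfEdge F // a.toVert = Sum.inr v} = (oddEndsAt φ₂ v.1).card := by
  rw [← Nat.card_eq_of_bijective _ (bijective_endsAt_inr F v), oddEndsAt,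
    Nat.subtype_card]
  intro d
  rw [Finset.mem_filter, hF]
  simp [sumColor]

lemma isEulerian_iff (hF : ∀ x, gluedEdge x ∈ F ↔ (sumColor φ₁ φ₂ x).IsOdd) :
    Multigraph.IsEulerian F ↔ IsEvenColoring φ₁ ∧ IsEvenColoring φ₂ := by
  constructor
  · exact fun h => ⟨fun v => card_oddEndsAt_inl hF v ▸ h (Sum.inl v),
      fun v => card_oddEndsAt_inr hF v ▸ h (Sum.inr v)⟩
  · rintro ⟨h1, h2⟩ (v | v)
    · rw [card_oddEndsAt_inl hF]; exact h1 v
    · rw [card_oddEndsAt_inr hF]; exact h2 v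

end Parity

open Classical in
/-- The colourings `φ₁`, `φ₂` of the edges of `F₁`, `F₂` correspond to the colouring `Φ` of the
edges of `F₁ * F₂`. -/
structure IsRestriction {F : Set (F₁.glue F₂).E} {ω : Multigraph.Orientation F}
    (Ω : OrientationExtension ω) (Φ : (F₁.glue F₂).E → Color k ℓ)
    (φ₁ : F₁.E → Color k ℓ) (φ₂ : F₂.E → Color k ℓ) : Prop where
  mem_iff : ∀ e, e ∈ F ↔ (Φ e).IsOdd
  sumColor_eq : ∀ x, sumColor φ₁ φ₂ x =
    if x ∈ Ω.incoming then Φ (gluedEdge x) else (Φ (gluedEdge x)).conj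
  isRight_eq : ∀ e, (Sum.elim φ₁ φ₂ e).isRight = (Φ (Quot.mk _ e)).isRight

/-- The element of the Grassmann algebra at a vertex of `F₁ * F₂`. -/
def vertexElement (Φ : (F₁.glue F₂).E → Color k ℓ) {F : Set (F₁.glue F₂).E}
    (κ : Multigraph.LocalPairing F) (v : (F₁.glue F₂).V) :
    Subalgebra.center ℂ (Grassmann (F₁.D ⊕ F₂.D)) :=
  ∏ p ∈ κ.pairs v, (Φ (gluedEdge (inclEnd p.2.1))).sgn •
    evenPair (gen (inclEnd p.1.1)) (gen (inclEnd p.2.1))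

namespace IsRestriction

variable {F : Set (F₁.glue F₂).E} {ω : Multigraph.Orientation F} {Ω : OrientationExtension ω}
  {Φ : (F₁.glue F₂).E → Color k ℓ} {φ₁ : F₁.E → Color k ℓ} {φ₂ : F₂.E → Color k ℓ}
  (H : IsRestriction Ω Φ φ₁ φ₂) {κ : Multigraph.LocalPairing F}

include H

lemma sumColor_of_mem {x : F₁.D ⊕ F₂.D} (hx : x ∈ Ω.incoming) :
    sumColor φ₁ φ₂ x = Φ (gluedEdge x) := by rw [H.sumColor_eq, if_pos hx]

lemma sumColor_of_notMem {x : F₁.D ⊕ F₂.D} (hx : x ∉ Ω.incoming) :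
    sumColor φ₁ φ₂ x = (Φ (gluedEdge x)).conj := by rw [H.sumColor_eq, if_neg hx]

lemma gluedEdge_mem_iff (x : F₁.D ⊕ F₂.D) : gluedEdge x ∈ F ↔ (sumColor φ₁ φ₂ x).IsOdd := by
  rw [H.mem_iff, H.sumColor_eq, Color.IsOdd, Color.IsOdd]
  split_ifs <;> simp

/-- Of two open ends with the same label exactly one is incoming, and both lie on one glued edge. -/
lemma labelColor_eq : labelColor φ₂ = fun i => (labelColor φ₁ i).conj := by
  funext i
  have h1 := H.sumColor_eq (Sum.inl (F₁.openEnd i))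
  have h2 := H.sumColor_eq (Sum.inr (F₂.openEnd i))
  rw [← gluedEdge_openEnd] at h2
  simp only [sumColor, Sum.elim_inl, Sum.elim_inr] at h1 h2
  simp only [labelColor, h1, h2]
  by_cases h : Sum.inl (F₁.openEnd i) ∈ Ω.incoming
  · rw [if_pos h, if_neg (by rw [Ω.openEnd_mem]; exact not_not.2 h)]
  · rw [if_neg h, if_pos ((Ω.openEnd_mem i).2 h), Color.conj_conj]

/-- The product over the edges does not depend on the orientation. -/
lemma prod_incoming [DecidableEq (F₁.D ⊕ F₂.D)] {A : Finset (F₁.D ⊕ F₂.D)}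
    (hA : ∀ x, x ∈ A ↔ gluedEdge x ∈ F ∧ x ∈ Ω.incoming) :
    ∏ x ∈ A, (sumColor φ₁ φ₂ x).sgn • evenPair (gen x) (gen (sumOpp x)) =
      ∏ x ∈ (oddHeads φ₁).disjSum (oddHeads φ₂),
        (sumColor φ₁ φ₂ x).sgn • evenPair (gen x) (gen (sumOpp x)) := by
  have hB : ∀ x, x ∈ (oddHeads φ₁).disjSum (oddHeads φ₂) ↔
      gluedEdge x ∈ F ∧ IsHead x := by
    intro x
    rw [H.gluedEdge_mem_iff]
    rcases x with d | d <;>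
      simp [oddHeads, sumColor, IsHead, and_comm]
  refine prod_transversal sumOpp_involutive ?_ ?_ ?_ ?_ ?_
  · intro x hx
    have ho := (H.gluedEdge_mem_iff x).1 ((hA x).1 hx).1
    rw [sumColor_sumOpp, Color.sgn_conj ho, sumOpp_involutive x, evenPair_swap, neg_smul, smul_neg]
    exact neg_neg _
  all_goals
    intro x
    simp only [hA, hB, gluedEdge_sumOpp, Ω.sumOpp_mem, isHead_sumOpp]
    tauto

open Classical in
/-- The contribution of the labelled vertices is the sign `glueSign`. -/
lemma coe_prod_label (κ : Multigraph.LocalPairing F) :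
    ((∏ i : {i : Fin t // gluedEdge (F₁ := F₁) (F₂ := F₂) (Sum.inl (F₁.openEnd i)) ∈ F},
      (Φ (gluedEdge (outEnd (κ := κ) Ω (Sum.inr i)))).sgn •
        evenPair (gen (inEnd (κ := κ) Ω (Sum.inr i))) (gen (outEnd (κ := κ) Ω (Sum.inr i))) :
      Subalgebra.center ℂ (Grassmann (F₁.D ⊕ F₂.D))) : Grassmann (F₁.D ⊕ F₂.D)) =
    glueSign (labelColor φ₁) • (mon ((F₁.labelList (labelColor φ₁)).map Sum.inl) *
      mon ((F₂.labelList (labelColor φ₂)).map Sum.inr)) := by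
  -- If the open end of F₁ is outgoing, the pair is listed in reverse; the sign from `evenPair_swap`
  -- cancels the one from `Color.sgn_conj`.
  have h1 : ∀ i : {i : Fin t // gluedEdge (F₁ := F₁) (F₂ := F₂) (Sum.inl (F₁.openEnd i)) ∈ F},
      (Φ (gluedEdge (outEnd (κ := κ) Ω (Sum.inr i)))).sgn •
        evenPair (gen (inEnd (κ := κ) Ω (Sum.inr i))) (gen (outEnd (κ := κ) Ω (Sum.inr i))) =
      (labelColor φ₁ i.1).sgn • evenPair (gen (Sum.inl (F₁.openEnd i.1)))
        (gen (Sum.inr (F₂.openEnd i.1))) := by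
    intro i
    simp only [inEnd, outEnd]
    by_cases hi : Sum.inl (F₁.openEnd i.1) ∈ Ω.incoming
    · rw [if_pos hi, if_pos hi, ← gluedEdge_openEnd, ← H.sumColor_of_mem hi]
      rfl
    · rw [if_neg hi, if_neg hi, evenPair_swap]
      have h2 := H.sumColor_of_notMem hi
      have h3 : labelColor φ₁ i.1 = (Φ (gluedEdge (Sum.inl (F₁.openEnd i.1)))).conj := h2
      rw [h3, Color.sgn_conj ((H.mem_iff _).1 i.2)]
      simp
  rw [Finset.prod_congr rfl fun i _ => h1 i]
  let L := (List.finRange t).filter fun i => (labelColor φ₁ i).IsOdd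
  have hL : ∀ i, i ∈ L.toFinset ↔
      gluedEdge (F₁ := F₁) (F₂ := F₂) (Sum.inl (F₁.openEnd i)) ∈ F := by
    intro i
    rw [H.gluedEdge_mem_iff]
    simp only [L, List.mem_toFinset, List.mem_filter, List.mem_finRange, true_and,
      decide_eq_true_eq]
    rfl
  rw [← Finset.prod_subtype L.toFinset hL (fun i => (labelColor φ₁ i).sgn •
    evenPair (gen (Sum.inl (F₁.openEnd i))) (gen (Sum.inr (F₂.openEnd i)))), Finset.prod_smul,
    List.prod_toFinset _ ((List.nodup_finRange t).filter _),
    List.prod_toFinset _ ((List.nodup_finRange t).filter _)]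
  change (L.map _).prod • ((L.map _).prod : Subalgebra.center ℂ _).1 = _
  rw [coe_list_prod_evenPair, smul_smul, H.labelColor_eq]
  simp only [labelList, List.map_map, Color.IsOdd, Color.isRight_conj]
  rfl

end IsRestriction

end Fragment

/-! ### Comparison of signs and factorization of the value of a colouring -/

lemma noncommProd_eq_map_prod {α R S : Type*} [CommMonoid R] [Monoid S] (s : Finset α)
    (r : R →* S) (f : α → R) (g : α → S) (comm) (h : ∀ x ∈ s, g x = r (f x)) :
    s.noncommProd g comm = r (∏ x ∈ s, f x) := by
  refine Eq.trans ?_ (congrArg r (Finset.noncommProd_eq_prod s f))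
  refine Eq.trans ?_ (Finset.map_noncommProd s f _ r).symm
  exact Finset.noncommProd_congr rfl h _

namespace Fragment

variable {t k ℓ : ℕ} {F₁ F₂ : Fragment t}

/-- A list of the half-edges of odd colour at a vertex of `F₁ * F₂`. -/
def vertexEnds (φ₁ : F₁.E → Color k ℓ) (φ₂ : F₂.E → Color k ℓ) :
    (F₁.glue F₂).V → List (F₁.D ⊕ F₂.D) :=
  Sum.elim (fun v => (oddEndsAt φ₁ v.1).toList.map Sum.inl)
    fun v => (oddEndsAt φ₂ v.1).toList.map Sum.inr

lemma nodup_vertexEnds (φ₁ : F₁.E → Color k ℓ) (φ₂ : F₂.E → Color k ℓ) (v : (F₁.glue F₂).V) :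
    (vertexEnds φ₁ φ₂ v).Nodup := by
  rcases v with v | v
  · exact (Finset.nodup_toList _).map Sum.inl_injective
  · exact (Finset.nodup_toList _).map Sum.inr_injective

lemma coe_prod_oddHeads (φ₁ : F₁.E → Color k ℓ) (φ₂ : F₂.E → Color k ℓ) :
    ((∏ x ∈ (oddHeads φ₁).disjSum (oddHeads φ₂),
      (sumColor φ₁ φ₂ x).sgn • evenPair (gen x) (gen (sumOpp x)) :
      Subalgebra.center ℂ (Grassmann (F₁.D ⊕ F₂.D))) : Grassmann (F₁.D ⊕ F₂.D)) =
    (edgeScalar φ₁ * edgeScalar φ₂) •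
      (mon ((interiorList φ₁ ++ F₁.labelList (labelColor φ₁)).map Sum.inl) *
        mon ((interiorList φ₂ ++ F₂.labelList (labelColor φ₂)).map Sum.inr)) := by
  rw [Finset.prod_disjSum, Subalgebra.coe_mul, ← smul_mul_smul_comm, ← grassmannHom_gen_mon,
    ← grassmannHom_gen_mon, ← map_smul, ← map_smul, ← edgeScalar_spec, ← edgeScalar_spec,
    grassmannHom_gen_prod_smul_evenPair, grassmannHom_gen_prod_smul_evenPair]
  rfl

lemma coe_prod_vertexElement {F : Set (F₁.glue F₂).E} {κ : Multigraph.LocalPairing F}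
    {Φ : (F₁.glue F₂).E → Color k ℓ} {φ₁ : F₁.E → Color k ℓ} {φ₂ : F₂.E → Color k ℓ}
    {δ : (F₁.glue F₂).V → ℂ}
    (hδ : ∀ v, (vertexElement Φ κ v : Grassmann (F₁.D ⊕ F₂.D)) =
      δ v • mon (vertexEnds φ₁ φ₂ v)) :
    ((∏ v, vertexElement Φ κ v : Subalgebra.center ℂ (Grassmann (F₁.D ⊕ F₂.D))) :
      Grassmann (F₁.D ⊕ F₂.D)) = (∏ v, δ v) • (mon ((interiorList φ₁).map Sum.inl) *
        mon ((interiorList φ₂).map Sum.inr)) := by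
  rw [prod_glue_V, prod_glue_V, Subalgebra.coe_mul,
    coe_prod_of_coe_eq_smul_mon _ _ _ _ (fun v => hδ (Sum.inl v)),
    coe_prod_of_coe_eq_smul_mon _ _ _ _ (fun v => hδ (Sum.inr v)), smul_mul_smul_comm]
  simp only [interiorList, List.map_flatMap]
  rfl

namespace IsRestriction

variable {F : Set (F₁.glue F₂).E} {ω : Multigraph.Orientation F} {Ω : OrientationExtension ω}
  {Φ : (F₁.glue F₂).E → Color k ℓ} {φ₁ : F₁.E → Color k ℓ} {φ₂ : F₂.E → Color k ℓ}
  (H : IsRestriction Ω Φ φ₁ φ₂) {κ : Multigraph.LocalPairing F}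

include H

lemma mem_vertexEnds (v : (F₁.glue F₂).V) (x : F₁.D ⊕ F₂.D) : x ∈ vertexEnds φ₁ φ₂ v ↔
    ∃ a : Multigraph.HalfEdge F, a.toVert = v ∧ inclEnd a.1 = x := by
  rcases v with v | v
  · simp only [vertexEnds, Sum.elim_inl, List.mem_map, Finset.mem_toList, oddEndsAt,
      Finset.mem_filter, Finset.mem_univ, true_and]
    constructor
    · rintro ⟨d, ⟨hd, ho⟩, rfl⟩
      exact ⟨⟨Sum.inl ⟨d, hd ▸ v.2⟩, (H.gluedEdge_mem_iff (Sum.inl d)).2 ho⟩,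
        congrArg Sum.inl (Subtype.ext hd), rfl⟩
    · rintro ⟨⟨d | d, h⟩, hv, rfl⟩
      · exact ⟨d.1, ⟨congrArg Subtype.val (Sum.inl_injective hv),
          (H.gluedEdge_mem_iff (Sum.inl d.1)).1 h⟩, rfl⟩
      · exact absurd hv Sum.inr_ne_inl
  · simp only [vertexEnds, Sum.elim_inr, List.mem_map, Finset.mem_toList, oddEndsAt,
      Finset.mem_filter, Finset.mem_univ, true_and]
    constructor
    · rintro ⟨d, ⟨hd, ho⟩, rfl⟩
      exact ⟨⟨Sum.inr ⟨d, hd ▸ v.2⟩, (H.gluedEdge_mem_iff (Sum.inr d)).2 ho⟩,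
        congrArg Sum.inr (Subtype.ext hd), rfl⟩
    · rintro ⟨⟨d | d, h⟩, hv, rfl⟩
      · exact absurd hv Sum.inl_ne_inr
      · exact ⟨d.1, ⟨congrArg Subtype.val (Sum.inr_injective hv),
          (H.gluedEdge_mem_iff (Sum.inr d.1)).1 h⟩, rfl⟩

/-- The pairs of κ at a vertex use each half-edge of `F` there once, and these are the half-edges of
odd colour. -/
lemma exists_vertexScalar (hκ : κ.Compatible ω) (v : (F₁.glue F₂).V) :
    ∃ s : ℂ, (vertexElement Φ κ v : Grassmann (F₁.D ⊕ F₂.D)) = s • mon (vertexEnds φ₁ φ₂ v) := by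
  refine exists_coe_prod_smul_evenPair _ _ ?_ ?_ ?_ (nodup_vertexEnds φ₁ φ₂ v) ?_
  · intro p hp p' hp' h
    have h' := Subtype.ext (inclEnd_injective h)
    have hv := (κ.mem_vert v p hp).1
    exact (κ.existsUnique p.1).unique ⟨by rwa [hv], Or.inl rfl⟩ ⟨by rwa [hv], Or.inl h'.symm⟩
  · intro p hp p' hp' h
    have h' := Subtype.ext (inclEnd_injective h)
    have hv := (κ.mem_vert v p hp).2
    exact (κ.existsUnique p.2).unique ⟨by rwa [hv], Or.inr rfl⟩ ⟨by rwa [hv], Or.inr h'.symm⟩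
  · intro p hp p' hp' h
    have h' := Subtype.ext (inclEnd_injective h)
    exact (hκ v p' hp').2 (h' ▸ (hκ v p hp).1)
  · intro x
    rw [H.mem_vertexEnds]
    constructor
    · rintro ⟨a, rfl, rfl⟩
      obtain ⟨p, ⟨hp, hpa⟩, -⟩ := κ.existsUnique a
      exact ⟨p, hp, hpa.imp (fun h => congrArg (fun a => inclEnd a.1) h.symm)
        fun h => congrArg (fun a => inclEnd a.1) h.symm⟩
    · rintro ⟨p, hp, rfl | rfl⟩
      · exact ⟨p.1, (κ.mem_vert v p hp).1, rfl⟩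
      · exact ⟨p.2, (κ.mem_vert v p hp).2, rfl⟩

open Classical in
/-- Rearranging the product over the edges into a product over the pairs of half-edges. -/
lemma sign_smul_prod_oddHeads (hκ : κ.Compatible ω) {π : Equiv.Perm (PairIndex κ)}
    (hπ : ∀ j, inEnd Ω (π j) = sumOpp (outEnd Ω j)) :
    ((Equiv.Perm.sign π : ℤ) : ℂ) • ∏ x ∈ (oddHeads φ₁).disjSum (oddHeads φ₂),
      (sumColor φ₁ φ₂ x).sgn • evenPair (gen x) (gen (sumOpp x)) =
    ∏ j : PairIndex κ, (Φ (gluedEdge (outEnd Ω j))).sgn •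
      evenPair (gen (inEnd Ω j)) (gen (outEnd Ω j)) := by
  have h1 := H.prod_incoming (A := Finset.univ.filter fun x => gluedEdge x ∈ F ∧ x ∈ Ω.incoming)
    (fun x => by simp)
  have h2 : Finset.univ.filter (fun x => gluedEdge x ∈ F ∧ x ∈ Ω.incoming) =
      Finset.univ.image (inEnd (κ := κ) Ω) := by
    ext x
    simp only [Finset.mem_filter, Finset.mem_univ, true_and, Finset.mem_image]
    constructor
    · exact fun hx => exists_inEnd Ω hκ hx.1 hx.2
    · rintro ⟨j, rfl⟩
      exact ⟨gluedEdge_inEnd_mem Ω j, inEnd_mem Ω hκ j⟩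
  -- Hence the pair products are those over edges with the second entries permuted by π.
  have h3 : ∀ j : PairIndex κ, outEnd Ω j = sumOpp (inEnd Ω (π j)) := fun j => by
    rw [hπ, sumOpp_involutive]
  have h4 : ∏ j : PairIndex κ, (Φ (gluedEdge (outEnd Ω j))).sgn =
      ∏ j : PairIndex κ, (sumColor φ₁ φ₂ (inEnd Ω j)).sgn := by
    rw [← Equiv.prod_comp π fun j => (sumColor φ₁ φ₂ (inEnd Ω j)).sgn]
    refine Finset.prod_congr rfl fun j _ => ?_
    rw [H.sumColor_of_mem (inEnd_mem Ω hκ _), h3 j, gluedEdge_sumOpp]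
  rw [← h1, h2, Finset.prod_image fun i _ j _ hij => inEnd_injective Ω hij, Finset.prod_smul,
    Finset.prod_smul, h4, smul_comm]
  congr 1
  rw [← prod_evenPair_perm π (fun j => gen (inEnd Ω j)) (fun j => gen (sumOpp (inEnd Ω j)))]
  exact Finset.prod_congr rfl fun j _ => by rw [h3 j]

open Classical in
/-- The scalars of the two fragments determine the scalars at the vertices. -/
lemma sign_mul_edgeScalar (hκ : κ.Compatible ω) {π : Equiv.Perm (PairIndex κ)}
    (hπ : ∀ j, inEnd Ω (π j) = sumOpp (outEnd Ω j)) (hev : IsEvenColoring φ₂)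
    {δ : (F₁.glue F₂).V → ℂ}
    (hδ : ∀ v, (vertexElement Φ κ v : Grassmann (F₁.D ⊕ F₂.D)) =
      δ v • mon (vertexEnds φ₁ φ₂ v)) :
    ((Equiv.Perm.sign π : ℤ) : ℂ) * (edgeScalar φ₁ * edgeScalar φ₂) =
      (∏ v, δ v) * glueSign (labelColor φ₁) := by
  have h1 := congrArg Subtype.val (H.sign_smul_prod_oddHeads hκ hπ)
  rw [Fintype.prod_sum_type, Fintype.prod_sigma] at h1
  have h2 : ∀ v : (F₁.glue F₂).V, (∏ p : {p // p ∈ κ.pairs v},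
      (Φ (gluedEdge (outEnd Ω (Sum.inl ⟨v, p⟩)))).sgn •
        evenPair (gen (inEnd Ω (Sum.inl ⟨v, p⟩))) (gen (outEnd Ω (Sum.inl ⟨v, p⟩)))) =
      vertexElement Φ κ v := fun v => Finset.prod_coe_sort (κ.pairs v)
        fun p => (Φ (gluedEdge (inclEnd p.2.1))).sgn •
          evenPair (gen (inclEnd p.1.1)) (gen (inclEnd p.2.1))
  rw [Finset.prod_congr rfl fun v _ => h2 v] at h1
  change _ • ((∏ x ∈ _, _ : Subalgebra.center ℂ (Grassmann (F₁.D ⊕ F₂.D))) :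
    Grassmann (F₁.D ⊕ F₂.D)) = ((∏ v, vertexElement Φ κ v :
      Subalgebra.center ℂ (Grassmann (F₁.D ⊕ F₂.D))) : Grassmann (F₁.D ⊕ F₂.D)) * _ at h1
  rw [coe_prod_oddHeads, coe_prod_vertexElement hδ] at h1
  erw [H.coe_prod_label κ] at h1
  -- Even degrees at the interior vertices of F₂ let its interior monomial pass the label monomial
  -- of F₁ without a sign.
  have hlen : Even ((interiorList φ₂).map (Sum.inr : F₂.D → F₁.D ⊕ F₂.D)).length := by
    rw [List.length_map, interiorList, List.length_flatMap]
    generalize (Finset.univ : Finset F₂.Interior).toList = L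
    induction L with
    | nil => simp
    | cons v L ih =>
      rw [List.map_cons, List.sum_cons, Finset.length_toList]
      exact (hev v).add ih
  rw [smul_smul, smul_mul_smul_comm] at h1
  have h3 : mon ((interiorList φ₁).map Sum.inl) * mon ((interiorList φ₂).map Sum.inr) *
      (mon ((F₁.labelList (labelColor φ₁)).map Sum.inl) *
        mon ((F₂.labelList (labelColor φ₂)).map Sum.inr)) =
      mon ((interiorList φ₁ ++ F₁.labelList (labelColor φ₁)).map Sum.inl) *
        mon ((interiorList φ₂ ++ F₂.labelList (labelColor φ₂)).map
          (Sum.inr : F₂.D → F₁.D ⊕ F₂.D)) := by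
    rw [List.map_append, List.map_append, mon_append, mon_append, mul_assoc, mul_assoc,
      ← mul_assoc (mon (List.map Sum.inr (interiorList φ₂))), ← commute_mon_of_even hlen,
      mul_assoc]
  rw [h3, ← mon_append] at h1
  refine smul_left_injective ℂ (mon_ne_zero ?_) h1
  refine ((nodup_interiorList_append φ₁).map Sum.inl_injective).append
    ((nodup_interiorList_append φ₂).map Sum.inr_injective) fun x hx hx' => ?_
  rw [List.mem_map] at hx hx'
  obtain ⟨d, -, rfl⟩ := hx
  obtain ⟨d', -, h⟩ := hx'
  exact Sum.inr_ne_inl h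

/-- The wedge at a vertex is the image of the universal element under substituting colour vectors
for generators. Scalars found in the Grassmann algebra therefore hold for every colouring, even
where the wedge vanishes. -/
lemma wedgeAt_eq (hκ : κ.Compatible ω) {φ : F → Fin (2 * ℓ)}
    (hφ : ∀ e : F, Φ e.1 = Sum.inr (φ e)) (v : (F₁.glue F₂).V) :
    wedgeAt κ φ v = grassmannHom (fun x => (sumColor φ₁ φ₂ x).vec)
      (vertexElement Φ κ v : Grassmann (F₁.D ⊕ F₂.D)) := by
  let r : Subalgebra.center ℂ (Grassmann (F₁.D ⊕ F₂.D)) →ₐ[ℂ] ExteriorAlgebra ℂ (Vec (2 * ℓ)) :=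
    (grassmannHom fun x => (sumColor φ₁ φ₂ x).vec).comp (Subalgebra.val _)
  refine noncommProd_eq_map_prod _ r.toRingHom.toMonoidHom _ _ _ fun p hp => ?_
  have hc := hκ v p hp
  change _ = grassmannHom _ ((Φ (gluedEdge (inclEnd p.2.1))).sgn •
    (evenPair (gen (inclEnd p.1.1)) (gen (inclEnd p.2.1))).1)
  rw [map_smul]
  rw [grassmannHom_evenPair, H.sumColor_of_mem ((Ω.inclEnd_mem _).2 hc.1),
    H.sumColor_of_notMem (fun h => hc.2 ((Ω.inclEnd_mem _).1 h)), ← edge_glue, ← edge_glue]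
  rw [show Φ ((F₁.glue F₂).edge p.1.1) = _ from hφ p.1.toEdge,
    show Φ ((F₁.glue F₂).edge p.2.1) = _ from hφ p.2.toEdge, wedgePair,
    Color.dualVec_eq (k := k), map_smul, mul_smul_comm]
  rfl

lemma symAt_inl {ψ : (Fᶜ : Set (F₁.glue F₂).E) → Fin k}
    (hψ : ∀ e : (Fᶜ : Set (F₁.glue F₂).E), Φ e.1 = Sum.inl (ψ e)) (v : F₁.Interior) :
    symAt ψ (Sum.inl v : (F₁.glue F₂).V) =
      ∏ d ∈ Finset.univ.filter fun d => F₁.vert d = v.1, (Multigraph.halfColor φ₁ d).sym := by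
  classical
  have h1 : ∀ d : F₁.D, (Multigraph.halfColor φ₁ d).sym =
      (Φ (gluedEdge (F₁ := F₁) (F₂ := F₂) (Sum.inl d))).sym := fun d => by
    rw [show Multigraph.halfColor φ₁ d = sumColor φ₁ φ₂ (Sum.inl d) from rfl, H.sumColor_eq]
    split_ifs <;> simp
  refine (Function.Bijective.prod_comp (bijective_endsAt_inl (F₂ := F₂) Fᶜ v) fun a =>
    SymmetricAlgebra.ι ℂ (Vec k) (basisVec (ψ a.1.toEdge))).symm.trans ?_
  rw [← Finset.prod_filter_of_ne (p := fun d : F₁.D =>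
    gluedEdge (F₁ := F₁) (F₂ := F₂) (Sum.inl d) ∈ Fᶜ), Finset.filter_filter,
    Finset.prod_subtype _ (p := fun d => F₁.vert d = v.1 ∧
      gluedEdge (F₁ := F₁) (F₂ := F₂) (Sum.inl d) ∈ Fᶜ) (fun d => by simp)]
  · refine Fintype.prod_congr _ _ fun d => ?_
    rw [h1]
    exact (congrArg Color.sym (hψ ⟨_, d.2.2⟩)).symm
  -- Half-edges of odd colour contribute the factor 1 to the symmetric part, so only those outside
  -- `F` matter.
  · intro d _ hd hF
    apply hd
    rw [h1]
    have ho := (H.mem_iff _).1 hF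
    generalize Φ (gluedEdge (F₁ := F₁) (F₂ := F₂) (Sum.inl d)) = c at ho ⊢
    rcases c with i | i
    · exact absurd ho Bool.false_ne_true
    · rfl

lemma symAt_inr {ψ : (Fᶜ : Set (F₁.glue F₂).E) → Fin k}
    (hψ : ∀ e : (Fᶜ : Set (F₁.glue F₂).E), Φ e.1 = Sum.inl (ψ e)) (v : F₂.Interior) :
    symAt ψ (Sum.inr v : (F₁.glue F₂).V) =
      ∏ d ∈ Finset.univ.filter fun d => F₂.vert d = v.1, (Multigraph.halfColor φ₂ d).sym := by
  classical
  have h1 : ∀ d : F₂.D, (Multigraph.halfColor φ₂ d).sym =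
      (Φ (gluedEdge (F₁ := F₁) (F₂ := F₂) (Sum.inr d))).sym := fun d => by
    rw [show Multigraph.halfColor φ₂ d = sumColor φ₁ φ₂ (Sum.inr d) from rfl, H.sumColor_eq]
    split_ifs <;> simp
  refine (Function.Bijective.prod_comp (bijective_endsAt_inr (F₁ := F₁) Fᶜ v) fun a =>
    SymmetricAlgebra.ι ℂ (Vec k) (basisVec (ψ a.1.toEdge))).symm.trans ?_
  rw [← Finset.prod_filter_of_ne (p := fun d : F₂.D =>
    gluedEdge (F₁ := F₁) (F₂ := F₂) (Sum.inr d) ∈ Fᶜ), Finset.filter_filter,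
    Finset.prod_subtype _ (p := fun d => F₂.vert d = v.1 ∧
      gluedEdge (F₁ := F₁) (F₂ := F₂) (Sum.inr d) ∈ Fᶜ) (fun d => by simp)]
  · refine Fintype.prod_congr _ _ fun d => ?_
    rw [h1]
    exact (congrArg Color.sym (hψ ⟨_, d.2.2⟩)).symm
  · intro d _ hd hF
    apply hd
    rw [h1]
    have ho := (H.mem_iff _).1 hF
    generalize Φ (gluedEdge (F₁ := F₁) (F₂ := F₂) (Sum.inr d)) = c at ho ⊢
    rcases c with i | i
    · exact absurd ho Bool.false_ne_true
    · rfl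

variable (h : EdgeColoringModel k ℓ)

/-- The value of a colouring of `F₁ * F₂` factors into weights of colourings of `F₁` and `F₂`. -/
lemma value_eq (hκ : κ.Compatible ω) (hF : Multigraph.IsEulerian F) {φ : F → Fin (2 * ℓ)}
    {ψ : (Fᶜ : Set (F₁.glue F₂).E) → Fin k} (hφ : ∀ e : F, Φ e.1 = Sum.inr (φ e))
    (hψ : ∀ e : (Fᶜ : Set (F₁.glue F₂).E), Φ e.1 = Sum.inl (ψ e)) :
    (-1) ^ κ.numCircuits * ∏ v, h (symAt ψ v ⊗ₜ[ℂ] wedgeAt κ φ v) =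
      glueSign (labelColor φ₁) * weight h φ₁ * weight h φ₂ := by
  classical
  obtain ⟨π, hπ⟩ := exists_perm Ω hκ
  choose δ hδ using fun v => H.exists_vertexScalar hκ v
  have h1 := H.sign_mul_edgeScalar hκ hπ ((isEulerian_iff H.gluedEdge_mem_iff).1 hF).2 hδ
  obtain ⟨W, hW₁, hW₂⟩ : ∃ W : (F₁.glue F₂).V → ℂ,
      (∀ v : F₁.Interior, W (Sum.inl v) = vertexValue h φ₁ v.1) ∧
      ∀ v : F₂.Interior, W (Sum.inr v) = vertexValue h φ₂ v.1 :=
    ⟨Sum.elim (fun v => vertexValue h φ₁ v.1) (fun v => vertexValue h φ₂ v.1),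
      fun _ => rfl, fun _ => rfl⟩
  have h2 : ∀ v : (F₁.glue F₂).V, h (symAt ψ v ⊗ₜ[ℂ] wedgeAt κ φ v) =
      δ v * W v := by
    intro v
    rw [H.wedgeAt_eq hκ hφ, hδ, map_smul, grassmannHom_mon, TensorProduct.tmul_smul, map_smul,
      smul_eq_mul]
    congr 1
    rcases v with v | v
    · rw [H.symAt_inl hψ, hW₁, vertexEnds, Sum.elim_inl, List.map_map]
      rfl
    · rw [H.symAt_inr hψ, hW₂, vertexEnds, Sum.elim_inr, List.map_map]
      rfl
  have h3 : Nat.card {e : F₁.E ⊕ F₂.E // Quot.mk (GlueRel F₁ F₂) e ∈ F} =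
      Nat.card {e // (φ₁ e).IsOdd} + Nat.card {e // (φ₂ e).IsOdd} := by
    rw [← Nat.card_sum]
    refine Nat.card_congr ((Equiv.subtypeEquivRight (q := fun e =>
      (Sum.elim φ₁ φ₂ e).IsOdd) fun e => ?_).trans Equiv.subtypeSum)
    refine (H.mem_iff _).trans ?_
    rw [Color.IsOdd, Color.IsOdd, H.isRight_eq]
  rw [neg_one_pow_numCircuits Ω hκ hπ, h3, Finset.prod_congr rfl fun v _ => h2 v,
    Finset.prod_mul_distrib, prod_glue_V W, weight, weight, pow_add]
  simp only [hW₁, hW₂]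
  have h4 := glueSign_mul_self (labelColor φ₁)
  have h5 : ((Equiv.Perm.sign π : ℤ) : ℂ) * ((Equiv.Perm.sign π : ℤ) : ℂ) = 1 := by
    rw [← Int.cast_mul, ← Units.val_mul, Int.units_mul_self]; simp
  -- Only sign π and the gluing sign need to square to 1; nothing is assumed about the scalars δ or
  -- the edge scalars.
  have h6 : ((Equiv.Perm.sign π : ℤ) : ℂ) * ∏ v, δ v =
      glueSign (labelColor φ₁) * (edgeScalar φ₁ * edgeScalar φ₂) := by
    linear_combination (-((Equiv.Perm.sign π : ℤ) : ℂ) * ∏ v, δ v) * h4 -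
      glueSign (labelColor φ₁) * ((Equiv.Perm.sign π : ℤ) : ℂ) * h1 +
      glueSign (labelColor φ₁) * (edgeScalar φ₁ * edgeScalar φ₂) * h5
  linear_combination ((-1) ^ Nat.card {e // (φ₁ e).IsOdd} * (-1) ^ Nat.card {e // (φ₂ e).IsOdd} *
    ((∏ v : F₁.Interior, vertexValue h φ₁ v.1) * ∏ v : F₂.Interior, vertexValue h φ₂ v.1)) * h6

end IsRestriction

end Fragment

/-! ### Summation over colourings -/

namespace Fragment

variable {t k ℓ : ℕ} {F₁ F₂ : Fragment t}

section Twist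

variable {F : Set (F₁.glue F₂).E} {ω : Multigraph.Orientation F} (Ω : OrientationExtension ω)

open Classical in
/-- Conjugation of the colour of an edge on which two orientations differ. -/
def twist (e : F₁.E ⊕ F₂.E) (c : Color k ℓ) : Color k ℓ :=
  if ∃ x, sumEdge x = e ∧ IsHead x ∧ x ∉ Ω.incoming then c.conj else c

@[simp] lemma twist_twist (e : F₁.E ⊕ F₂.E) (c : Color k ℓ) : twist Ω e (twist Ω e c) = c := by
  unfold twist
  split_ifs <;> simp

@[simp] lemma isRight_twist (e : F₁.E ⊕ F₂.E) (c : Color k ℓ) :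
    (twist Ω e c).isRight = c.isRight := by
  unfold twist
  split_ifs <;> simp

open Classical in
lemma twist_sumEdge {x : F₁.D ⊕ F₂.D} (hx : IsHead x) (c : Color k ℓ) :
    twist Ω (sumEdge x) c = if x ∈ Ω.incoming then c else c.conj := by
  have h : (∃ y, sumEdge y = sumEdge x ∧ IsHead y ∧ y ∉ Ω.incoming) ↔ x ∉ Ω.incoming := by
    constructor
    · rintro ⟨y, hy, hy', hyi⟩
      rcases eq_or_eq_sumOpp hy with rfl | rfl
      · exact hyi
      · exact absurd hx ((isHead_sumOpp x).1 hy')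
    · exact fun h => ⟨x, rfl, hx, h⟩
  unfold twist
  rw [if_congr h rfl rfl, ite_not]

open Classical in
-- Fragment colourings are read along `heads`, colourings of the glued graph along `Ω`. Twisting
-- translates between the two conventions.
lemma sumColor_eq_twist (φ₁ : F₁.E → Color k ℓ) (φ₂ : F₂.E → Color k ℓ) (x : F₁.D ⊕ F₂.D) :
    sumColor φ₁ φ₂ x = if x ∈ Ω.incoming then twist Ω (sumEdge x) (Sum.elim φ₁ φ₂ (sumEdge x))
      else (twist Ω (sumEdge x) (Sum.elim φ₁ φ₂ (sumEdge x))).conj := by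
  have h : sumColor φ₁ φ₂ x = if IsHead x then Sum.elim φ₁ φ₂ (sumEdge x)
      else (Sum.elim φ₁ φ₂ (sumEdge x)).conj := by
    rcases x with d | d <;> rfl
  rw [h]
  by_cases hx : IsHead x
  · rw [if_pos hx, twist_sumEdge Ω hx]
    split_ifs <;> simp
  · have h' := twist_sumEdge Ω ((isHead_sumOpp x).2 hx) (Sum.elim φ₁ φ₂ (sumEdge x))
    rw [sumEdge_sumOpp] at h'
    rw [if_neg hx, h', if_congr (Ω.sumOpp_mem x) rfl rfl]
    by_cases hi : x ∈ Ω.incoming <;> simp [hi]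

lemma isRestriction_of_twist {Φ : (F₁.glue F₂).E → Color k ℓ} {φ₁ : F₁.E → Color k ℓ}
    {φ₂ : F₂.E → Color k ℓ} (hΦ : ∀ e, e ∈ F ↔ (Φ e).IsOdd)
    (h : ∀ e, Sum.elim φ₁ φ₂ e = twist Ω e (Φ (Quot.mk _ e))) : IsRestriction Ω Φ φ₁ φ₂ where
  mem_iff := hΦ
  sumColor_eq x := by
    rw [sumColor_eq_twist Ω, h, twist_twist]
    rfl
  isRight_eq e := by rw [h, isRight_twist]

/-- This is the condition for a pair of fragment colourings, once twisted, to descend to the glued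
edges. -/
lemma twist_openEnd {φ₁ : F₁.E → Color k ℓ} {φ₂ : F₂.E → Color k ℓ}
    (h : labelColor φ₂ = fun i => (labelColor φ₁ i).conj) (i : Fin t) :
    twist Ω (Sum.inl (F₁.edge (F₁.openEnd i))) (φ₁ (F₁.edge (F₁.openEnd i))) =
      twist Ω (Sum.inr (F₂.edge (F₂.openEnd i))) (φ₂ (F₂.edge (F₂.openEnd i))) := by
  have h1 := sumColor_eq_twist Ω φ₁ φ₂ (Sum.inl (F₁.openEnd i))
  have h2 := sumColor_eq_twist Ω φ₁ φ₂ (Sum.inr (F₂.openEnd i))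
  have h3 : sumColor φ₁ φ₂ (Sum.inr (F₂.openEnd i)) =
    (sumColor φ₁ φ₂ (Sum.inl (F₁.openEnd i))).conj := congrFun h i
  rw [h1, h2] at h3
  by_cases hi : Sum.inl (F₁.openEnd i) ∈ Ω.incoming
  · rw [if_pos hi, if_neg (by rw [Ω.openEnd_mem]; exact not_not.2 hi)] at h3
    have := congrArg Color.conj h3
    rw [Color.conj_conj, Color.conj_conj] at this
    exact this.symm
  · rw [if_neg hi, if_pos ((Ω.openEnd_mem i).2 hi), Color.conj_conj] at h3
    exact h3.symm

end Twist

/-- The edges of `F₁ * F₂` that contain an edge of odd colour. -/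
def oddSet (φ₁ : F₁.E → Color k ℓ) (φ₂ : F₂.E → Color k ℓ) : Set (F₁.glue F₂).E :=
  {q | ∃ e, Quot.mk _ e = q ∧ (Sum.elim φ₁ φ₂ e).IsOdd}

lemma mem_oddSet {φ₁ : F₁.E → Color k ℓ} {φ₂ : F₂.E → Color k ℓ}
    (h : labelColor φ₂ = fun i => (labelColor φ₁ i).conj) (e : F₁.E ⊕ F₂.E) :
    (Quot.mk _ e : (F₁.glue F₂).E) ∈ oddSet φ₁ φ₂ ↔ (Sum.elim φ₁ φ₂ e).IsOdd := by
  let m : (F₁.glue F₂).E → Bool := Quot.lift (fun e => (Sum.elim φ₁ φ₂ e).isRight) (by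
    rintro _ _ ⟨i, rfl, rfl⟩
    have := congrArg Sum.isRight (congrFun h i)
    simp only [labelColor, Multigraph.isRight_halfColor, Color.isRight_conj] at this
    exact this.symm)
  constructor
  · rintro ⟨e', he', ho⟩
    exact (congrArg m he').symm.trans ho
  · exact fun ho => ⟨e, rfl, ho⟩

lemma gluedEdge_mem_oddSet {φ₁ : F₁.E → Color k ℓ} {φ₂ : F₂.E → Color k ℓ}
    (h : labelColor φ₂ = fun i => (labelColor φ₁ i).conj) (x : F₁.D ⊕ F₂.D) :
    gluedEdge x ∈ oddSet φ₁ φ₂ ↔ (sumColor φ₁ φ₂ x).IsOdd := by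
  refine (mem_oddSet h _).trans ?_
  rcases x with d | d <;> simp [sumEdge, sumColor]

open Classical in
/-- The pairs of colourings of `F₁` and `F₂` that fit together and have even degrees. -/
def compatiblePairs (F₁ F₂ : Fragment t) (k ℓ : ℕ) :
    Finset ((F₁.E → Color k ℓ) × (F₂.E → Color k ℓ)) :=
  Finset.univ.filter fun p => (IsEvenColoring p.1 ∧ IsEvenColoring p.2) ∧
    labelColor p.2 = fun i => (labelColor p.1 i).conj

variable (h : EdgeColoringModel k ℓ)

open Classical in
-- For fixed `F`, the maps φ and ψ combine into one colouring of F₁ * F₂ whose odd edges form `F`;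
-- twisting matches these bijectively with the pairs on the right. The right side involves neither κ
-- nor ω, which is why any compatible choice gives the same value.
lemma partialValue_eq {F : Set (F₁.glue F₂).E} (hF : Multigraph.IsEulerian F)
    {κ : Multigraph.LocalPairing F} {ω : Multigraph.Orientation F} (hκ : κ.Compatible ω) :
    partialValue h κ = ∑ p ∈ (compatiblePairs F₁ F₂ k ℓ).filter fun p => oddSet p.1 p.2 = F,
      glueSign (labelColor p.1) * weight h p.1 * weight h p.2 := by
  obtain ⟨Ω⟩ := nonempty_orientationExtension ω
  let color : (F → Fin (2 * ℓ)) × ((Fᶜ : Set (F₁.glue F₂).E) → Fin k) →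
      (F₁.glue F₂).E → Color k ℓ := fun p e =>
    if he : e ∈ F then Sum.inr (p.1 ⟨e, he⟩) else Sum.inl (p.2 ⟨e, he⟩)
  have hc1 : ∀ p (e : F), color p e.1 = Sum.inr (p.1 e) := fun p e => dif_pos e.2
  have hc2 : ∀ p (e : (Fᶜ : Set (F₁.glue F₂).E)), color p e.1 = Sum.inl (p.2 e) :=
    fun p e => dif_neg e.2
  have hodd : ∀ p e, e ∈ F ↔ (color p e).IsOdd := by
    intro p e
    by_cases he : e ∈ F
    · exact iff_of_true he (by rw [show color p e = _ from hc1 p ⟨e, he⟩]; rfl)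
    · exact iff_of_false he (by
        rw [show color p e = _ from hc2 p ⟨e, he⟩]; exact Bool.false_ne_true)
  let r : (F → Fin (2 * ℓ)) × ((Fᶜ : Set (F₁.glue F₂).E) → Fin k) →
      (F₁.E → Color k ℓ) × (F₂.E → Color k ℓ) := fun p =>
    (fun e => twist Ω (Sum.inl e) (color p (Quot.mk _ (Sum.inl e))),
      fun e => twist Ω (Sum.inr e) (color p (Quot.mk _ (Sum.inr e))))
  have hr : ∀ p e, Sum.elim (r p).1 (r p).2 e = twist Ω e (color p (Quot.mk _ e)) := by
    rintro p (e | e) <;> rfl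
  have H : ∀ p, IsRestriction Ω (color p) (r p).1 (r p).2 := fun p =>
    isRestriction_of_twist Ω (hodd p) (hr p)
  rw [partialValue, ← Fintype.sum_prod_type', Finset.mul_sum]
  refine Finset.sum_bij (fun p _ => r p) ?_ ?_ ?_ ?_
  · intro p _
    rw [Finset.mem_filter, compatiblePairs, Finset.mem_filter]
    have hl := (H p).labelColor_eq
    refine ⟨⟨Finset.mem_univ _, (isEulerian_iff (H p).gluedEdge_mem_iff).1 hF, hl⟩, ?_⟩
    ext ⟨e⟩
    refine (mem_oddSet hl e).trans ?_
    rw [hr, Color.IsOdd, isRight_twist]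
    exact (hodd p _).symm
  · intro p _ p' _ hpp
    have hcol : color p = color p' := by
      funext e
      obtain ⟨e, rfl⟩ := Quot.exists_rep e
      have h1 := (hr p e).symm.trans ((congrArg (fun q => Sum.elim q.1 q.2 e) hpp).trans (hr p' e))
      exact (twist_twist Ω e _).symm.trans ((congrArg (twist Ω e) h1).trans (twist_twist Ω e _))
    refine Prod.ext (funext fun e => ?_) (funext fun e => ?_)
    · have := congrFun hcol e.1
      rw [hc1, hc1] at this
      exact Sum.inr_injective this
    · have := congrFun hcol e.1
      rw [hc2, hc2] at this
      exact Sum.inl_injective this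
  · rintro ⟨φ₁, φ₂⟩ hp
    simp only [Finset.mem_filter, compatiblePairs, Finset.mem_univ, true_and] at hp
    obtain ⟨⟨-, hl⟩, rfl⟩ := hp
    -- The inverse of `r`: twisting is an involution, and matching label colours make the result
    -- constant on glued edges.
    let Φ : (F₁.glue F₂).E → Color k ℓ :=
      Quot.lift (fun e => twist Ω e (Sum.elim φ₁ φ₂ e)) (by
        rintro _ _ ⟨i, rfl, rfl⟩
        exact twist_openEnd Ω hl i)
    have hΦ : ∀ e : (F₁.glue F₂).E, e ∈ oddSet φ₁ φ₂ ↔ (Φ e).IsOdd := by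
      rintro ⟨e⟩
      refine (mem_oddSet hl e).trans ?_
      change _ ↔ (twist Ω e _).isRight = true
      rw [isRight_twist]
    have h1 : ∀ e : oddSet φ₁ φ₂, ∃ i, Φ e.1 = Sum.inr i := fun e =>
      Sum.isRight_iff.1 ((hΦ e.1).1 e.2)
    have h2 : ∀ e : ((oddSet φ₁ φ₂)ᶜ : Set (F₁.glue F₂).E), ∃ i, Φ e.1 = Sum.inl i := fun e =>
      Sum.isLeft_iff.1 (by
        have := e.2
        rw [Set.mem_compl_iff, hΦ] at this
        simpa [Color.IsOdd] using this)
    choose φ hφ using h1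
    choose ψ hψ using h2
    have hcol : color (φ, ψ) = Φ := by
      funext e
      by_cases he : e ∈ oddSet φ₁ φ₂
      · exact (hc1 (φ, ψ) ⟨e, he⟩).trans (hφ ⟨e, he⟩).symm
      · exact (hc2 (φ, ψ) ⟨e, he⟩).trans (hψ ⟨e, he⟩).symm
    refine ⟨(φ, ψ), Finset.mem_univ _, Prod.ext (funext fun e => ?_) (funext fun e => ?_)⟩
    · have := hr (φ, ψ) (Sum.inl e)
      rw [hcol] at this
      exact this.trans (twist_twist Ω _ _)
    · have := hr (φ, ψ) (Sum.inr e)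
      rw [hcol] at this
      exact this.trans (twist_twist Ω _ _)
  · intro p _
    exact (H p).value_eq h hκ hF (hc1 p) (hc2 p)

/-- The Eulerian sets index the fibres of `oddSet`: even degrees of the odd edges are exactly
evenness of both colourings. -/
lemma partitionFunction_glue_eq_sum (F₁ F₂ : Fragment t) : partitionFunction h (F₁.glue F₂) =
    ∑ p ∈ compatiblePairs F₁ F₂ k ℓ, glueSign (labelColor p.1) * weight h p.1 * weight h p.2 := by
  classical
  rw [← Finset.sum_fiberwise_of_maps_to (s := compatiblePairs F₁ F₂ k ℓ)
    (t := Finset.univ.filter fun F => Multigraph.IsEulerian F) (g := fun p => oddSet p.1 p.2)]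
  · rw [Finset.sum_subtype (p := fun F => Multigraph.IsEulerian F) _ (fun F => by simp),
      partitionFunction]
    refine Fintype.sum_congr _ _ fun F => ?_
    obtain ⟨ω, -, hκ⟩ := (Multigraph.exists_compatible F.2).choose_spec
    rw [eulerianValue]
    convert partialValue_eq h F.2 hκ
  · intro p hp
    rw [compatiblePairs, Finset.mem_filter] at hp
    rw [Finset.mem_filter]
    exact ⟨Finset.mem_univ _, (isEulerian_iff (gluedEdge_mem_oddSet hp.2.2)).2 hp.2.1⟩

/-- The mixed partition function of `F₁ * F₂` is a bilinear form in the coordinate vectors. -/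
lemma partitionFunction_glue (F₁ F₂ : Fragment t) : partitionFunction h (F₁.glue F₂) =
    ∑ c : Fin t → Color k ℓ, coordinates h F₁ c *
      (glueSign c * coordinates h F₂ fun i => (c i).conj) := by
  classical
  rw [partitionFunction_glue_eq_sum, compatiblePairs, Finset.sum_filter]
  simp only [coordinates, Finset.mul_sum, Finset.sum_mul]
  rw [Finset.sum_comm, Fintype.sum_prod_type, Finset.sum_comm]
  refine Fintype.sum_congr _ _ fun φ₂ => ?_
  rw [Finset.sum_comm]
  refine Fintype.sum_congr _ _ fun φ₁ => ?_
  -- A colouring of F₁ contributes to a single coordinate, that of its own label colours.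
  rw [Finset.sum_eq_single (labelColor φ₁)]
  · by_cases h1 : IsEvenColoring φ₁ <;> by_cases h2 : IsEvenColoring φ₂ <;>
      by_cases h3 : labelColor φ₂ = fun i => (labelColor φ₁ i).conj <;> simp [h1, h2, h3]
    ring
  · intro c _ hc
    rw [if_neg fun h => hc h.2.symm, zero_mul]
  · exact fun h => absurd (Finset.mem_univ _) h

end Fragment

/-! ### The rank bound -/

lemma eRank_mul_le_left {m o : Type*} {n : Type} [Fintype n] (A : Matrix m n ℂ)
    (B : Matrix n o ℂ) : (A * B).eRank ≤ A.eRank := by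
  refine OrderHom.mono (β := ℕ∞) Cardinal.toENat (Submodule.rank_mono (show
    Submodule.span ℂ (Set.range (A * B).col) ≤ Submodule.span ℂ (Set.range A.col) from ?_))
  rw [Submodule.span_le]
  rintro _ ⟨j, rfl⟩
  have : (A * B).col j = ∑ i, B i j • A.col i := by
    ext x
    simp [Matrix.mul_apply, mul_comm]
  rw [this]
  exact Submodule.sum_mem _ fun i _ => Submodule.smul_mem _ _ (Submodule.subset_span ⟨i, rfl⟩)

/-- The matrix is a product whose inner index runs over the (k + 2ℓ)^t colourings of the labels. -/
lemma eRank_edgeConnectionMatrix_le {k ℓ : ℕ} (h : EdgeColoringModel k ℓ) (t : ℕ) :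
    (edgeConnectionMatrix (partitionFunction h) t).eRank ≤ (((k + 2 * ℓ) ^ t : ℕ) : ℕ∞) := by
  let A : Matrix (Fragment t) (Fin t → Color k ℓ) ℂ := Matrix.of fun F => Fragment.coordinates h F
  let B : Matrix (Fin t → Color k ℓ) (Fragment t) ℂ := Matrix.of fun c F =>
    Fragment.glueSign c * Fragment.coordinates h F fun i => (c i).conj
  have hAB : edgeConnectionMatrix (partitionFunction h) t = A * B := by
    refine Matrix.ext fun F₁ F₂ => ?_
    rw [Matrix.mul_apply]
    simp only [edgeConnectionMatrix, Matrix.of_apply, A, B]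
    exact Fragment.partitionFunction_glue h F₁ F₂
  rw [hAB]
  refine (eRank_mul_le_left A B).trans (A.eRank_le_card_width.trans ?_)
  rw [ENat.card_eq_coe_fintype_card]
  simp

end MixedPartition

end

theorem mainTheorem1 (k ℓ : ℕ) (h : MixedPartition.EdgeColoringModel k ℓ) :
    (∀ t : ℕ,
      (MixedPartition.edgeConnectionMatrix (MixedPartition.partitionFunction h) t).eRank ≤
        (((k + 2 * ℓ) ^ t : ℕ) : ℕ∞)) ∧
    MixedPartition.HasFiniteEdgeRankConnectivity (MixedPartition.partitionFunction h) := by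
  have hle := MixedPartition.eRank_edgeConnectionMatrix_le h
  -- The maximum with 1 keeps the base positive when k = ℓ = 0.
  refine ⟨hle, max 1 ((k + 2 * ℓ : ℕ) : ℝ), by positivity, fun t => ?_⟩
  obtain ⟨n, hn⟩ := ENat.ne_top_iff_exists.1 (ne_top_of_le_ne_top (ENat.natCast_ne_top _) (hle t))
  refine ⟨n, hn.symm, ?_⟩
  have h1 : n ≤ (k + 2 * ℓ) ^ t := by
    have := hle t
    rw [← hn] at this
    exact_mod_cast this
  calc (n : ℝ) ≤ (((k + 2 * ℓ : ℕ) : ℝ)) ^ t := by exact_mod_cast h1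
    _ ≤ _ := by gcongr; exact le_max_right _ _
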